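/- For an integer $y\ge 2$ let $\alpha_y(n)=1$ if every prime dividing $n$ is $>y$, and $\alpha_y(n)=0$ otherwise; let $P_y=\prod_{p\le y}(1-1/p)$ (here and below $p$ denotes a prime). For integers $X,H\ge 1$ put \[ V(X,H,y)=\frac1X\int_0^X\Big(\sum_{x<n\le x+H}\alpha_y(n)-HP_y\Big)^2dx, \] \[ M(H,y)=\prod_{2<p\le y}\Big(1-\frac2p\Big)\sum_{n\ge1}g_y(n)\Big\{\frac{H}{2n}\Big\}\Big(1-\Big\{\frac{H}{2n}\Big\}\Big), \] where $\{\cdot\}$ is the fractional part and $g_y$ is the multiplicative function supported on squarefree integers with $g_y(p)=p/(p-2)$ if $2<p\le y$ and $g_y(p)=0$ for all other primes $p$. For real $x\ge 1$ let \[ \Psi_\omega(x,y)=\sum_{\substack{n\le x\\ p\mid n\Rightarrow p\le y}}2^{\omega(n)}\mu^2(n), \] where $\omega(n)$ is the number of distinct prime factors of $n$ and $\mu$ is the M\"obius function. \textbf{Proposition.} There are an absolute constant $C>0$ and a function $\varepsilon:[1,\infty)\to[-1,1]$ with $\varepsilon(u)\to0$ as $u\to\infty$ such that, for all integers $y\ge2$,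 $H\ge1$, $X\ge1$ and all real $u\ge1$, \[ |V(X,H,y)-M(H,y)|\le C\,H^2\Big(P_y\,u^{-u(1+\varepsilon(u))}+\frac{\Psi_\omega(y^u,y)}{X}\Big). \] In other words, $V(X,H,y)=M(H,y)+O\big(H^2(P_yu^{-u(1+o(1))}+\Psi_\omega(y^u,y)/X)\big)$ with an absolute implied constant, the $o(1)$ being a bounded function of $u$ that tends to $0$ as $u\to\infty$. -/

import Mathlib

open scoped Classical in
/-- The indicator of the integers without prime factors `≤ y`. -/
noncomputable def alphaSifted (y n : ℕ) : ℝ :=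
  if ∀ p : ℕ, p.Prime → p ∣ n → y < p then 1 else 0

/-- The density `P_y = ∏_{p ≤ y} (1 - 1/p)` of the sifted integers. -/
noncomputable def siftedDensity (y : ℕ) : ℝ :=
  ∏ p ∈ (Finset.Icc 1 y).filter Nat.Prime, (1 - 1 / (p : ℝ))

/-- The variance `V(X,H,y)`. For `x ≥ 0`, the integers `n` with `x < n ≤ x + H` are those with
`⌊x⌋ < n ≤ ⌊x + H⌋`. -/
noncomputable def siftedVariance (X H y : ℕ) : ℝ :=
  (1 / (X : ℝ)) * ∫ x in (0 : ℝ)..(X : ℝ),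
    ((∑ n ∈ Finset.Ioc ⌊x⌋₊ ⌊x + (H : ℝ)⌋₊, alphaSifted y n) - (H : ℝ) * siftedDensity y) ^ 2

open scoped Classical in
/-- The multiplicative function `g_y`, supported on squarefree integers, with
`g_y(p) = p / (p - 2)` for primes `2 < p ≤ y` and `g_y(p) = 0` for all other primes. -/
noncomputable def gSifted (y n : ℕ) : ℝ :=
  if Squarefree n then
    ∏ p ∈ n.primeFactors, (if 2 < p ∧ p ≤ y then (p : ℝ) / ((p : ℝ) - 2) else 0)
  else 0

/-- The main term `M(H,y)`. The term `n = 0` of the series is zero because `g_y(0) = 0`, and only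
finitely many terms are nonzero (`gSifted_support_finite`). -/
noncomputable def siftedMainTerm (H y : ℕ) : ℝ :=
  (∏ p ∈ (Finset.Icc 1 y).filter (fun p => p.Prime ∧ 2 < p), (1 - 2 / (p : ℝ))) *
    ∑' n : ℕ, gSifted y n *
      (Int.fract ((H : ℝ) / (2 * (n : ℝ))) * (1 - Int.fract ((H : ℝ) / (2 * (n : ℝ)))))

/-- `Ψ_ω(x,y)`: the sum of `2^{ω(n)} μ(n)^2` over the `y`-friable integers `1 ≤ n ≤ x`. -/
noncomputable def friableOmegaSum (x : ℝ) (y : ℕ) : ℝ :=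
  ∑ n ∈ (Finset.Icc 1 ⌊x⌋₊).filter (fun n => ∀ p ∈ n.primeFactors, p ≤ y),
    (2 : ℝ) ^ (ArithmeticFunction.cardDistinctFactors n) *
      ((ArithmeticFunction.moebius n : ℤ) : ℝ) ^ 2

theorem gSifted_zero (y : ℕ) : gSifted y 0 = 0 := by
  simp [gSifted]

theorem gSifted_support_finite (y : ℕ) : (Function.support (gSifted y)).Finite := by
  refine ((Finset.Icc 1 y).powerset.image (fun s => ∏ p ∈ s, p)).finite_toSet.subset ?_
  intro n hn
  rw [Function.mem_support] at hn
  unfold gSifted at hn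
  split_ifs at hn with hsq
  · rw [Finset.prod_ne_zero_iff] at hn
    simp only [Finset.coe_image, Set.mem_image, Finset.mem_coe, Finset.mem_powerset]
    refine ⟨n.primeFactors, fun p hp => ?_, Nat.prod_primeFactors_of_squarefree hsq⟩
    have h := hn p hp
    rw [Finset.mem_Icc]
    by_cases hc : 2 < p ∧ p ≤ y
    · exact ⟨by omega, hc.2⟩
    · simp [hc] at h
  · exact absurd rfl hn

/-! The window sum is constant for `x` in `[m, m + 1)`, so V is a mean over integers `m < X`.
Opening the square reduces it to the correlations ∑_m α(m+i)α(m+j), the linear term being the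
diagonal case i = j. If each correlation is replaced by X times its local density `pairDensity`, the
result is exactly M(H,y): expanding the local factors over squarefree odd moduli N leaves the count
of pairs i, j < H congruent mod 2N, whose smooth part H²/(2N) adds up to H²P² and whose fractional
part gives the terms of M (`sum_pairDensity_eq`).

What remains is a two-dimensional fundamental lemma, uniform in i and j, with remainder Ψ_ω(y^u, y)
and relative error u^(-u(1+o(1))). It comes from the Brun–Hooley sieve (`brun_hooley`). The primes
up to y are cut into blocks j with p about y^(K^(-j)), K = 2^k, and inclusion–exclusion in block j
is truncated at n + 2j, with n odd. The surviving moduli are at most y^(n(1+2/K)+4), so n may be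
taken as (1 - o(1))u. The reciprocals of the primes of one block sum to O(k) by Chebyshev, so the
relative error is O_k(1)^n / n!, which is u^(-u(1+o(1))).

For bounded u only the order of magnitude is needed; it follows by sieving up to a small power of y
(`exists_sum_alphaSifted_le`). Finally the loss δ is made a function of u tending to 0
(`exists_tendsto_zero`). -/

open Finset

/-! ### Truncated inclusion–exclusion -/

/-- The weighted sum `∑_{S ⊆ A} w(|S|) ∏_{p ∈ S} x_p`. -/
noncomputable def cardWeightedSum (w : ℕ → ℝ) (A : Finset ℕ) (x : ℕ → ℝ) : ℝ :=
  ∑ S ∈ A.powerset, w S.card * ∏ p ∈ S, x p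

/-- The weights `(-1)^k` for `k < n` and `0` otherwise. -/
noncomputable def truncWeight (n k : ℕ) : ℝ := if k < n then (-1) ^ k else 0

/-- The indicator weight of `k = n`. -/
noncomputable def exactWeight (n k : ℕ) : ℝ := if k = n then 1 else 0

theorem cardWeightedSum_insert (w : ℕ → ℝ) {A : Finset ℕ} {a : ℕ} (ha : a ∉ A) (x : ℕ → ℝ) :
    cardWeightedSum w (insert a A) x =
      cardWeightedSum w A x + x a * cardWeightedSum (fun k => w (k + 1)) A x := by
  unfold cardWeightedSum
  rw [sum_powerset_insert ha, mul_sum]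
  congr 1
  refine sum_congr rfl fun S hS => ?_
  have haS : a ∉ S := fun h => ha (mem_powerset.1 hS h)
  rw [card_insert_of_notMem haS, prod_insert haS]
  ring

theorem cardWeightedSum_empty (w : ℕ → ℝ) (x : ℕ → ℝ) : cardWeightedSum w ∅ x = w 0 := by
  simp [cardWeightedSum]

theorem cardWeightedSum_zero (A : Finset ℕ) (x : ℕ → ℝ) :
    cardWeightedSum (fun _ => 0) A x = 0 := by
  simp [cardWeightedSum]

theorem cardWeightedSum_neg (w : ℕ → ℝ) (A : Finset ℕ) (x : ℕ → ℝ) :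
    cardWeightedSum (fun k => -w k) A x = -cardWeightedSum w A x := by
  simp [cardWeightedSum]

theorem truncWeight_zero : truncWeight 0 = fun _ => 0 := by
  funext k; simp [truncWeight]

theorem truncWeight_succ_succ (n : ℕ) :
    (fun k => truncWeight (n + 1) (k + 1)) = fun k => -truncWeight n k := by
  funext k
  simp only [truncWeight, add_lt_add_iff_right]
  split_ifs <;> simp [pow_succ]

theorem exactWeight_zero_succ : (fun k => exactWeight 0 (k + 1)) = fun _ => 0 := by
  funext k; simp [exactWeight]

theorem exactWeight_succ_succ (n : ℕ) :
    (fun k => exactWeight (n + 1) (k + 1)) = exactWeight n := by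
  funext k; simp [exactWeight]

theorem cardWeightedSum_exactWeight_nonneg (n : ℕ) (A : Finset ℕ) {x : ℕ → ℝ}
    (hx : ∀ p ∈ A, 0 ≤ x p) : 0 ≤ cardWeightedSum (exactWeight n) A x := by
  refine sum_nonneg fun S hS => mul_nonneg ?_
    (prod_nonneg fun p hp => hx p (mem_powerset.1 hS hp))
  unfold exactWeight
  split_ifs <;> simp

theorem cardWeightedSum_exactWeight_zero (A : Finset ℕ) (x : ℕ → ℝ) :
    cardWeightedSum (exactWeight 0) A x = 1 := by
  induction A using Finset.induction_on with
  | empty => simp [cardWeightedSum_empty, exactWeight]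
  | insert a A ha ih =>
    rw [cardWeightedSum_insert _ ha, ih, exactWeight_zero_succ, cardWeightedSum_zero]; ring

/-- Bonferroni inequalities, for independent events of probabilities `x_p`. -/
theorem bonferroni (A : Finset ℕ) {x : ℕ → ℝ} (hx : ∀ p ∈ A, 0 ≤ x p ∧ x p ≤ 1) (n : ℕ) :
    0 ≤ (-1) ^ n * (∏ p ∈ A, (1 - x p) - cardWeightedSum (truncWeight n) A x) ∧
      (-1) ^ n * (∏ p ∈ A, (1 - x p) - cardWeightedSum (truncWeight n) A x) ≤
        cardWeightedSum (exactWeight n) A x := by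
  induction A using Finset.induction_on generalizing n with
  | empty =>
    cases n <;> simp [cardWeightedSum_empty, exactWeight, truncWeight]
  | insert a A ha ih =>
    have hxA : ∀ p ∈ A, 0 ≤ x p ∧ x p ≤ 1 := fun p hp => hx p (mem_insert_of_mem hp)
    have hxa := hx a (mem_insert_self a A)
    cases n with
    | zero =>
      rw [cardWeightedSum_exactWeight_zero, truncWeight_zero, cardWeightedSum_zero]
      simp only [pow_zero, sub_zero, one_mul]
      exact ⟨prod_nonneg fun p hp => by linarith [(hx p hp).2],
        prod_le_one (fun p hp => by linarith [(hx p hp).2]) fun p hp => by linarith [(hx p hp).1]⟩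
    | succ n =>
      obtain ⟨h1, h2⟩ := ih hxA (n + 1)
      obtain ⟨h3, h4⟩ := ih hxA n
      rw [prod_insert ha, cardWeightedSum_insert _ ha, cardWeightedSum_insert _ ha,
        truncWeight_succ_succ, exactWeight_succ_succ, cardWeightedSum_neg]
      -- Adjoining `a` adds `x a` times the error of order `n` to the error of order `n + 1`. The
      -- alternating sign makes both contributions nonnegative.
      have key : (-1 : ℝ) ^ (n + 1) * ((1 - x a) * ∏ p ∈ A, (1 - x p) -
          (cardWeightedSum (truncWeight (n + 1)) A x +
            x a * -cardWeightedSum (truncWeight n) A x)) =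
          (-1) ^ (n + 1) * (∏ p ∈ A, (1 - x p) - cardWeightedSum (truncWeight (n + 1)) A x) +
          x a * ((-1) ^ n * (∏ p ∈ A, (1 - x p) - cardWeightedSum (truncWeight n) A x)) := by
        ring
      rw [key]
      exact ⟨add_nonneg h1 (mul_nonneg hxa.1 h3), add_le_add h2 (mul_le_mul_of_nonneg_left h4 hxa.1)⟩

/-- Odd truncation overshoots, so every block factor is nonnegative and factors of different blocks
can be multiplied. -/
theorem bonferroni_odd (A : Finset ℕ) {x : ℕ → ℝ} (hx : ∀ p ∈ A, 0 ≤ x p ∧ x p ≤ 1) {n : ℕ}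
    (hn : Odd n) :
    ∏ p ∈ A, (1 - x p) ≤ cardWeightedSum (truncWeight n) A x ∧
      cardWeightedSum (truncWeight n) A x ≤
        ∏ p ∈ A, (1 - x p) + cardWeightedSum (exactWeight n) A x := by
  have h := bonferroni A hx n
  rw [hn.neg_one_pow] at h
  constructor <;> linarith [h.1, h.2]

theorem pow_succ_add_le (n : ℕ) {s x : ℝ} (hs : 0 ≤ s) (hx : 0 ≤ x) :
    s ^ (n + 1) + (n + 1) * x * s ^ n ≤ (s + x) ^ (n + 1) := by
  induction n with
  | zero => simp
  | succ n ih =>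
    have h := mul_le_mul_of_nonneg_left ih (add_nonneg hs hx)
    have h2 : 0 ≤ (n + 1) * x ^ 2 * s ^ n := by positivity
    push_cast
    calc s ^ (n + 1 + 1) + (n + 1 + 1) * x * s ^ (n + 1)
        ≤ (s + x) * (s ^ (n + 1) + (n + 1) * x * s ^ n) := by
          have : (s + x) * (s ^ (n + 1) + (n + 1) * x * s ^ n) =
            s ^ (n + 1 + 1) + (n + 1 + 1) * x * s ^ (n + 1) + (n + 1) * x ^ 2 * s ^ n := by ring
          linarith
      _ ≤ _ := by rw [pow_succ' (s + x) (n + 1)]; exact h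

/-- Each `n`-subset occurs `n!` times when the `n`-th power of the sum is expanded. The induction
needs only the first two terms of the binomial expansion. -/
theorem cardWeightedSum_exactWeight_le (A : Finset ℕ) {x : ℕ → ℝ} (hx : ∀ p ∈ A, 0 ≤ x p)
    (n : ℕ) : cardWeightedSum (exactWeight n) A x ≤ (∑ p ∈ A, x p) ^ n / n.factorial := by
  induction A using Finset.induction_on generalizing n with
  | empty =>
    cases n <;> simp [cardWeightedSum_empty, exactWeight]
  | insert a A ha ih =>
    have hxA : ∀ p ∈ A, 0 ≤ x p := fun p hp => hx p (mem_insert_of_mem hp)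
    have hxa := hx a (mem_insert_self a A)
    cases n with
    | zero => simp [cardWeightedSum_exactWeight_zero]
    | succ n =>
      rw [cardWeightedSum_insert _ ha, exactWeight_succ_succ, sum_insert ha]
      have h1 := ih hxA (n + 1)
      have h2 := mul_le_mul_of_nonneg_left (ih hxA n) hxa
      set s := ∑ p ∈ A, x p with hs
      have hs0 : 0 ≤ s := sum_nonneg hxA
      have h3 := pow_succ_add_le n hs0 hxa
      have hf : (0 : ℝ) < n.factorial := by exact_mod_cast n.factorial_pos
      calc _ ≤ s ^ (n + 1) / (n + 1).factorial + x a * (s ^ n / n.factorial) := add_le_add h1 h2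
        _ = (s ^ (n + 1) + (n + 1) * x a * s ^ n) / (n + 1).factorial := by
          rw [Nat.factorial_succ]; push_cast; field_simp
        _ ≤ _ := by rw [add_comm (x a)]; gcongr

/-! ### The Brun–Hooley sieve -/

theorem sum_powerset_disjoint_union {A B : Finset ℕ} (h : Disjoint A B) (f : Finset ℕ → ℝ) :
    ∑ S ∈ (A ∪ B).powerset, f S = ∑ S ∈ A.powerset, ∑ U ∈ B.powerset, f (S ∪ U) := by
  induction B using Finset.induction_on generalizing f with
  | empty => simp
  | insert b B hb ih =>
    have hbA : b ∉ A := fun hA => disjoint_left.1 h hA (mem_insert_self b B)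
    have hAB : Disjoint A B := h.mono_right (subset_insert b B)
    rw [union_insert, sum_powerset_insert (by simp [hb, hbA]), ih hAB, ih hAB,
      ← sum_add_distrib]
    refine sum_congr rfl fun S _ => ?_
    rw [sum_powerset_insert hb]
    simp [union_insert]

/-- Expansion of a product of weighted sums over the blocks `{p ∈ A : J p = j}`. -/
theorem prod_cardWeightedSum (A : Finset ℕ) (J : ℕ → ℕ) (w : ℕ → ℕ → ℝ) (x : ℕ → ℝ) (t : ℕ) :
    ∏ j ∈ range t, cardWeightedSum (w j) (A.filter (fun p => J p = j)) x =
      ∑ S ∈ (A.filter (fun p => J p < t)).powerset,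
        (∏ j ∈ range t, w j (S.filter (fun p => J p = j)).card) * ∏ p ∈ S, x p := by
  induction t with
  | zero => simp
  | succ t ih =>
    have hdisj : Disjoint (A.filter (fun p => J p < t)) (A.filter (fun p => J p = t)) := by
      rw [disjoint_left]; intro p hp hq
      simp only [mem_filter] at hp hq; omega
    have hun : A.filter (fun p => J p < t + 1) =
        A.filter (fun p => J p < t) ∪ A.filter (fun p => J p = t) := by
      ext p; simp only [mem_filter, mem_union, Nat.lt_succ_iff_lt_or_eq]; tauto
    rw [prod_range_succ, ih, hun, sum_powerset_disjoint_union hdisj, sum_mul]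
    refine sum_congr rfl fun S hS => ?_
    rw [cardWeightedSum, mul_sum]
    refine sum_congr rfl fun U hU => ?_
    rw [mem_powerset] at hS hU
    have hSU : Disjoint S U := disjoint_of_subset_left hS (disjoint_of_subset_right hU hdisj)
    have hUt : ∀ p ∈ U, J p = t := fun p hp => (mem_filter.1 (hU hp)).2
    have hSt : ∀ p ∈ S, J p < t := fun p hp => (mem_filter.1 (hS hp)).2
    rw [prod_range_succ, prod_union hSU]
    have e1 : (S ∪ U).filter (fun p => J p = t) = U := by
      ext p; simp only [mem_filter, mem_union]
      constructor
      · rintro ⟨h | h, h'⟩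
        · exact absurd h' (hSt p h).ne
        · exact h
      · exact fun h => ⟨Or.inr h, hUt p h⟩
    have e2 : ∀ j ∈ range t, w j ((S ∪ U).filter (fun p => J p = j)).card =
        w j (S.filter (fun p => J p = j)).card := by
      intro j hj
      congr 2
      ext p; simp only [mem_filter, mem_union]
      constructor
      · rintro ⟨h | h, h'⟩
        · exact ⟨h, h'⟩
        · have := hUt p h; rw [mem_range] at hj; omega
      · exact fun h => ⟨Or.inl h.1, h.2⟩
    rw [e1, prod_congr rfl e2]
    ring

/-- Exchange `b j` for `a j` one index at a time: each exchange costs at most `c j`, and the other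
factors are bounded by `b`. -/
theorem prod_sub_prod_le {t : ℕ} {a b c : ℕ → ℝ} (ha : ∀ j, 0 ≤ a j) (hab : ∀ j, a j ≤ b j)
    (hbc : ∀ j, b j ≤ a j + c j) :
    ∏ j ∈ range t, b j - ∏ j ∈ range t, a j ≤
      ∑ l ∈ range t, ∏ j ∈ range t, (if j = l then c j else b j) := by
  induction t with
  | zero => simp
  | succ t ih =>
    have hb : ∀ j, 0 ≤ b j := fun j => (ha j).trans (hab j)
    have hB : 0 ≤ ∏ j ∈ range t, b j := prod_nonneg fun j _ => hb j
    have hAB : ∏ j ∈ range t, a j ≤ ∏ j ∈ range t, b j :=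
      prod_le_prod (fun j _ => ha j) fun j _ => hab j
    rw [prod_range_succ, prod_range_succ, sum_range_succ]
    have e1 : ∀ l ∈ range t, ∏ j ∈ range (t + 1), (if j = l then c j else b j) =
        (∏ j ∈ range t, (if j = l then c j else b j)) * b t := by
      intro l hl
      rw [prod_range_succ, if_neg (by rw [mem_range] at hl; omega)]
    have e2 : ∏ j ∈ range (t + 1), (if j = t then c j else b j) = (∏ j ∈ range t, b j) * c t := by
      rw [prod_range_succ, if_pos rfl]
      congr 1
      refine prod_congr rfl fun j hj => if_neg (by rw [mem_range] at hj; omega)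
    rw [sum_congr rfl e1, ← sum_mul, e2]
    nlinarith [mul_le_mul_of_nonneg_right ih (hb t),
      mul_le_mul_of_nonneg_left (hbc t) hB, mul_nonneg (sub_nonneg.2 hAB) (sub_nonneg.2 (hab t))]

/-- The sets with fewer than `n j` elements in every block `j < t`, except for at most one block
where there may be `n j` elements. -/
def IsBlockAdmissible (J : ℕ → ℕ) (n : ℕ → ℕ) (t : ℕ) (S : Finset ℕ) : Prop :=
  ∃ l, ∀ j < t, (S.filter (fun p => J p = j)).card ≤ n j ∧
    (j ≠ l → (S.filter (fun p => J p = j)).card < n j)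

theorem abs_truncWeight_le (n k : ℕ) : |truncWeight n k| ≤ 1 := by
  unfold truncWeight; split_ifs <;> simp

theorem abs_exactWeight_le (n k : ℕ) : |exactWeight n k| ≤ 1 := by
  unfold exactWeight; split_ifs <;> simp

-- This is the total coefficient of a set with block counts `k j` in the approximant and in its
-- error bound. A block with `k l ≥ n l` kills the truncated product and every error term except the
-- `l`-th, so no factor `t` is lost in the remainder.
open scoped Classical in
theorem sum_abs_prod_weights_le (n k : ℕ → ℕ) (t : ℕ) :
    |∏ j ∈ range t, truncWeight (n j) (k j)| +
      ∑ l ∈ range t, |∏ j ∈ range t, (if j = l then exactWeight (n j) (k j)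
        else truncWeight (n j) (k j))| ≤
      if ∃ l, ∀ j < t, k j ≤ n j ∧ (j ≠ l → k j < n j) then 1 else 0 := by
  have hle : ∀ l, |∏ j ∈ range t, (if j = l then exactWeight (n j) (k j)
        else truncWeight (n j) (k j))| ≤ 1 := by
    intro l
    rw [abs_prod]
    refine prod_le_one (fun _ _ => abs_nonneg _) fun j _ => ?_
    split_ifs
    · exact abs_exactWeight_le _ _
    · exact abs_truncWeight_le _ _
  by_cases h : ∀ j < t, k j < n j
  · rw [if_pos ⟨0, fun j hj => ⟨(h j hj).le, fun _ => h j hj⟩⟩]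
    have h0 : ∀ l ∈ range t, |∏ j ∈ range t, (if j = l then exactWeight (n j) (k j)
        else truncWeight (n j) (k j))| = 0 := by
      intro l hl
      rw [abs_eq_zero]
      refine prod_eq_zero hl ?_
      rw [if_pos rfl, exactWeight, if_neg (h l (mem_range.1 hl)).ne]
    rw [sum_eq_zero h0, add_zero, abs_prod]
    exact prod_le_one (fun _ _ => abs_nonneg _) fun j _ => abs_truncWeight_le _ _
  · push Not at h
    obtain ⟨l, hl, hkl⟩ := h
    have h1 : ∏ j ∈ range t, truncWeight (n j) (k j) = 0 :=
      prod_eq_zero (mem_range.2 hl) (by rw [truncWeight, if_neg (by omega)])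
    have h0 : ∀ i ∈ range t, i ≠ l → |∏ j ∈ range t, (if j = i then exactWeight (n j) (k j)
        else truncWeight (n j) (k j))| = 0 := by
      intro i _ hil
      rw [abs_eq_zero]
      refine prod_eq_zero (mem_range.2 hl) ?_
      rw [if_neg (Ne.symm hil), truncWeight, if_neg (by omega)]
    rw [h1, sum_eq_single_of_mem l (mem_range.2 hl) h0, abs_zero, zero_add]
    by_cases hc : ∃ l, ∀ j < t, k j ≤ n j ∧ (j ≠ l → k j < n j)
    · rw [if_pos hc]; exact hle l
    · rw [if_neg hc]
      have : ∃ j < t, ¬ (k j ≤ n j ∧ (j ≠ l → k j < n j)) := by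
        by_contra hcon
        push Not at hcon
        exact hc ⟨l, fun j hj => hcon j hj⟩
      obtain ⟨j, hj, hjn⟩ := this
      refine le_of_eq (abs_eq_zero.2 (prod_eq_zero (mem_range.2 hj) ?_))
      by_cases hjl : j = l
      · rw [if_pos hjl, exactWeight, if_neg]
        intro he; exact hjn ⟨he.le, fun h => absurd hjl h⟩
      · rw [if_neg hjl, truncWeight, if_neg]
        intro he; exact hjn ⟨he.le, fun _ => he⟩

theorem abs_average_sub_le {A : Finset ℕ} {X : ℕ} {x : ℕ → ℕ → ℝ} {ρ : ℕ → ℝ} {M : Finset ℕ → ℝ}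
    (hcount : ∀ S ⊆ A, |∑ m ∈ range X, ∏ p ∈ S, x m p - X * ∏ p ∈ S, ρ p| ≤ M S)
    (c : Finset ℕ → ℝ) :
    |∑ m ∈ range X, ∑ S ∈ A.powerset, c S * ∏ p ∈ S, x m p -
      X * ∑ S ∈ A.powerset, c S * ∏ p ∈ S, ρ p| ≤ ∑ S ∈ A.powerset, |c S| * M S := by
  rw [sum_comm, mul_sum, ← sum_sub_distrib]
  refine (abs_sum_le_sum_abs _ _).trans (sum_le_sum fun S hS => ?_)
  rw [← mul_sum, ← mul_assoc, mul_comm (X : ℝ), mul_assoc, ← mul_sub, abs_mul]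
  exact mul_le_mul_of_nonneg_left (hcount S (mem_powerset.1 hS)) (abs_nonneg _)

open scoped Classical in
/-- The Brun–Hooley sieve. -/
theorem brun_hooley {A : Finset ℕ} {X t : ℕ} {J n : ℕ → ℕ} {x : ℕ → ℕ → ℝ} {ρ : ℕ → ℝ}
    {M : Finset ℕ → ℝ}
    (hJ : ∀ p ∈ A, J p < t) (hn : ∀ j, Odd (n j))
    (hx : ∀ m, ∀ p ∈ A, 0 ≤ x m p ∧ x m p ≤ 1) (hρ : ∀ p ∈ A, 0 ≤ ρ p ∧ ρ p ≤ 1)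
    (hM : ∀ S, 0 ≤ M S)
    (hcount : ∀ S ⊆ A, |∑ m ∈ range X, ∏ p ∈ S, x m p - X * ∏ p ∈ S, ρ p| ≤ M S) :
    |∑ m ∈ range X, ∏ p ∈ A, (1 - x m p) - X * ∏ p ∈ A, (1 - ρ p)| ≤
      2 * X * ∑ l ∈ range t, ∏ j ∈ range t,
        (if j = l then cardWeightedSum (exactWeight (n j)) (A.filter (fun p => J p = j)) ρ
          else cardWeightedSum (truncWeight (n j)) (A.filter (fun p => J p = j)) ρ) +
      ∑ S ∈ A.powerset.filter (IsBlockAdmissible J n t), M S := by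
  set T : (ℕ → ℝ) → ℕ → ℝ :=
    fun v j => cardWeightedSum (truncWeight (n j)) (A.filter (fun p => J p = j)) v with hT
  set N : (ℕ → ℝ) → ℕ → ℝ :=
    fun v j => cardWeightedSum (exactWeight (n j)) (A.filter (fun p => J p = j)) v with hN
  set F : (ℕ → ℝ) → ℝ := fun v => ∏ j ∈ range t, T v j with hF
  set G : (ℕ → ℝ) → ℝ :=
    fun v => ∑ l ∈ range t, ∏ j ∈ range t, (if j = l then N v j else T v j) with hG
  have hfilter : A.filter (fun p => J p < t) = A := filter_true_of_mem hJ
  have hFexp : ∀ v, F v = ∑ S ∈ A.powerset,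
      (∏ j ∈ range t, truncWeight (n j) (S.filter (fun p => J p = j)).card) * ∏ p ∈ S, v p := by
    intro v
    have := prod_cardWeightedSum A J (fun j => truncWeight (n j)) v t
    rwa [hfilter] at this
  have hGexp : ∀ v, G v = ∑ S ∈ A.powerset,
      (∑ l ∈ range t, ∏ j ∈ range t, (if j = l
        then exactWeight (n j) (S.filter (fun p => J p = j)).card
        else truncWeight (n j) (S.filter (fun p => J p = j)).card)) * ∏ p ∈ S, v p := by
    intro v
    simp_rw [hG, sum_mul]
    rw [sum_comm]
    refine sum_congr rfl fun l _ => ?_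
    have := prod_cardWeightedSum A J
      (fun j k => if j = l then exactWeight (n j) k else truncWeight (n j) k) v t
    rw [hfilter] at this
    rw [← this]
    refine prod_congr rfl fun j _ => ?_
    by_cases hjl : j = l
    · simp [hjl, hN]
    · simp [hjl, hT]
  have hdiff : ∀ v : ℕ → ℝ, (∀ p ∈ A, 0 ≤ v p ∧ v p ≤ 1) →
      |∏ p ∈ A, (1 - v p) - F v| ≤ G v := by
    intro v hv
    have hprod : ∏ p ∈ A, (1 - v p) =
        ∏ j ∈ range t, ∏ p ∈ A.filter (fun p => J p = j), (1 - v p) :=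
      (prod_fiberwise_of_maps_to (fun p hp => mem_range.2 (hJ p hp)) _).symm
    have hvf : ∀ j, ∀ p ∈ A.filter (fun p => J p = j), 0 ≤ v p ∧ v p ≤ 1 :=
      fun j p hp => hv p (mem_filter.1 hp).1
    have hI : ∀ j, 0 ≤ ∏ p ∈ A.filter (fun p => J p = j), (1 - v p) :=
      fun j => prod_nonneg fun p hp => by linarith [(hvf j p hp).2]
    have hb := fun j => bonferroni_odd _ (hvf j) (hn j)
    have h1 := prod_sub_prod_le (t := t) hI (fun j => (hb j).1) (fun j => (hb j).2)
    have h2 : ∏ p ∈ A, (1 - v p) ≤ F v := by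
      rw [hprod]; exact prod_le_prod (fun j _ => hI j) fun j _ => (hb j).1
    rw [abs_of_nonpos (by linarith), hprod, neg_sub]
    exact h1
  have hFc := abs_average_sub_le hcount
    (fun S => ∏ j ∈ range t, truncWeight (n j) (S.filter (fun p => J p = j)).card)
  have hGc := abs_average_sub_le hcount
    (fun S => ∑ l ∈ range t, ∏ j ∈ range t, (if j = l
        then exactWeight (n j) (S.filter (fun p => J p = j)).card
        else truncWeight (n j) (S.filter (fun p => J p = j)).card))
  simp_rw [← hFexp] at hFc
  simp_rw [← hGexp] at hGc
  have hrem : ∑ S ∈ A.powerset,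
        |∏ j ∈ range t, truncWeight (n j) (S.filter (fun p => J p = j)).card| * M S +
      ∑ S ∈ A.powerset, |∑ l ∈ range t, ∏ j ∈ range t, (if j = l
        then exactWeight (n j) (S.filter (fun p => J p = j)).card
        else truncWeight (n j) (S.filter (fun p => J p = j)).card)| * M S ≤
      ∑ S ∈ A.powerset.filter (IsBlockAdmissible J n t), M S := by
    rw [← sum_add_distrib, sum_filter]
    refine sum_le_sum fun S _ => ?_
    rw [← add_mul]
    have h := sum_abs_prod_weights_le n (fun j => (S.filter (fun p => J p = j)).card) t
    have h' := mul_le_mul_of_nonneg_right ((add_le_add_right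
      (abs_sum_le_sum_abs _ (range t)) _).trans h) (hM S)
    refine h'.trans (le_of_eq ?_)
    rw [ite_mul, one_mul, zero_mul]
    exact if_congr Iff.rfl rfl rfl
  -- The error `G` enters once for each `x m` and once for `ρ`. Its average over `m` is in turn
  -- compared with `X * G ρ`, whence the factor 2 in the main error and the two remainders joined in
  -- `hrem`.
  have h1 : |∑ m ∈ range X, ∏ p ∈ A, (1 - x m p) - ∑ m ∈ range X, F (x m)| ≤
      ∑ m ∈ range X, G (x m) := by
    rw [← sum_sub_distrib]
    exact (abs_sum_le_sum_abs _ _).trans (sum_le_sum fun m _ => hdiff _ (hx m))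
  have h2 : |X * ∏ p ∈ A, (1 - ρ p) - X * F ρ| ≤ X * G ρ := by
    rw [← mul_sub, abs_mul, Nat.abs_cast]
    exact mul_le_mul_of_nonneg_left (hdiff ρ hρ) (Nat.cast_nonneg X)
  have h3 : 2 * (X : ℝ) * ∑ l ∈ range t, ∏ j ∈ range t,
        (if j = l then cardWeightedSum (exactWeight (n j)) (A.filter (fun p => J p = j)) ρ
          else cardWeightedSum (truncWeight (n j)) (A.filter (fun p => J p = j)) ρ) =
      2 * X * G ρ := rfl
  rw [h3]
  rw [abs_le] at *
  constructor <;> linarith [h1.1, h1.2, h2.1, h2.2, hFc.1, hFc.2, hGc.1, hGc.2]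

/-- Bound for the main error term of the Brun–Hooley sieve. -/
theorem brun_hooley_error_le {A : Finset ℕ} {t : ℕ} {J n : ℕ → ℕ} {ρ σ : ℕ → ℝ}
    (hJ : ∀ p ∈ A, J p < t) (hn : ∀ j, Odd (n j)) (hρ : ∀ p ∈ A, 0 ≤ ρ p ∧ ρ p ≤ 1)
    (hσ : ∀ j, 0 ≤ σ j)
    (hN : ∀ j, cardWeightedSum (exactWeight (n j)) (A.filter (fun p => J p = j)) ρ ≤
      σ j * ∏ p ∈ A.filter (fun p => J p = j), (1 - ρ p)) :
    ∑ l ∈ range t, ∏ j ∈ range t,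
        (if j = l then cardWeightedSum (exactWeight (n j)) (A.filter (fun p => J p = j)) ρ
          else cardWeightedSum (truncWeight (n j)) (A.filter (fun p => J p = j)) ρ) ≤
      (∏ p ∈ A, (1 - ρ p)) * ((∑ j ∈ range t, σ j) * Real.exp (∑ j ∈ range t, σ j)) := by
  set I : ℕ → ℝ := fun j => ∏ p ∈ A.filter (fun p => J p = j), (1 - ρ p) with hIdef
  have hρf : ∀ j, ∀ p ∈ A.filter (fun p => J p = j), 0 ≤ ρ p ∧ ρ p ≤ 1 :=
    fun j p hp => hρ p (mem_filter.1 hp).1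
  have hI : ∀ j, 0 ≤ I j := fun j => prod_nonneg fun p hp => by linarith [(hρf j p hp).2]
  have hprod : ∏ p ∈ A, (1 - ρ p) = ∏ j ∈ range t, I j :=
    (prod_fiberwise_of_maps_to (fun p hp => mem_range.2 (hJ p hp)) _).symm
  have hb := fun j => bonferroni_odd _ (hρf j) (hn j)
  rw [hprod, sum_mul, mul_sum]
  refine sum_le_sum fun l hl => ?_
  -- A truncated factor is at most `(1 + σ j) * I j`, hence at most `exp (σ j) * I j`. In the
  -- exceptional block the exponential is inserted only for uniformity.
  calc ∏ j ∈ range t,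
        (if j = l then cardWeightedSum (exactWeight (n j)) (A.filter (fun p => J p = j)) ρ
          else cardWeightedSum (truncWeight (n j)) (A.filter (fun p => J p = j)) ρ)
      ≤ ∏ j ∈ range t, I j * ((if j = l then σ l else 1) * Real.exp (σ j)) := by
        refine prod_le_prod (fun j _ => ?_) fun j _ => ?_
        · split_ifs
          · exact cardWeightedSum_exactWeight_nonneg _ _ fun p hp => (hρf j p hp).1
          · exact (hI j).trans (hb j).1
        · split_ifs with hjl
          · subst hjl
            have h1 := hN j
            have h2 : 1 ≤ Real.exp (σ j) := Real.one_le_exp (hσ j)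
            have h3 : 0 ≤ I j * σ j := mul_nonneg (hI j) (hσ j)
            calc _ ≤ σ j * I j := h1
              _ = I j * σ j * 1 := by ring
              _ ≤ I j * σ j * Real.exp (σ j) := mul_le_mul_of_nonneg_left h2 h3
              _ = _ := by ring
          · have h1 := (hb j).2
            have h2 := hN j
            have h3 := mul_le_mul_of_nonneg_left (Real.add_one_le_exp (σ j)) (hI j)
            have h4 : I j = ∏ p ∈ A.filter (fun p => J p = j), (1 - ρ p) := rfl
            rw [← h4] at h1 h2
            linarith
    _ = _ := by
        rw [prod_mul_distrib, prod_mul_distrib, prod_ite_eq' , if_pos hl, Real.exp_sum]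

/-! ### Local densities and residue classes for pairs -/

/-- The number of residues `m` mod `p` with `p ∣ m + i` or `p ∣ m + j`. -/
noncomputable def pairRoots (i j p : ℕ) : ℕ := if i ≡ j [MOD p] then 1 else 2

/-- The indicator of `p ∣ m + i` or `p ∣ m + j`. -/
noncomputable def pairDvd (i j m p : ℕ) : ℝ := if p ∣ m + i ∨ p ∣ m + j then 1 else 0

/-- The primes up to `y`. -/
def primesUpTo (y : ℕ) : Finset ℕ := (Icc 1 y).filter Nat.Prime

/-- The density of the `m` such that `m + i` and `m + j` have no prime factor `≤ y`. -/
noncomputable def pairDensity (y i j : ℕ) : ℝ :=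
  ∏ p ∈ primesUpTo y, (1 - (pairRoots i j p : ℝ) / p)

theorem mem_primesUpTo {y p : ℕ} : p ∈ primesUpTo y ↔ p.Prime ∧ p ≤ y := by
  simp only [primesUpTo, mem_filter, mem_Icc]
  constructor
  · rintro ⟨⟨_, h⟩, hp⟩; exact ⟨hp, h⟩
  · rintro ⟨hp, h⟩; exact ⟨⟨hp.one_lt.le, h⟩, hp⟩

theorem abs_sum_modEq_sub_le (X r : ℕ) {q : ℕ} (hq : 0 < q) :
    |∑ m ∈ range X, (if m ≡ r [MOD q] then (1 : ℝ) else 0) - X / q| ≤ 1 := by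
  have h1 : ∑ m ∈ range X, (if m ≡ r [MOD q] then (1 : ℝ) else 0) =
      ((X.count (· ≡ r [MOD q]) : ℕ) : ℝ) := by
    rw [Nat.count_eq_card_filter_range, sum_boole]
  have hq' : (0 : ℝ) < q := by exact_mod_cast hq
  rw [h1, Nat.count_modEq_card X hq]
  have h2 : (X : ℝ) = q * (X / q : ℕ) + (X % q : ℕ) := by exact_mod_cast (Nat.div_add_mod X q).symm
  have h3 : ((X % q : ℕ) : ℝ) < q := by exact_mod_cast Nat.mod_lt X hq
  have h4 : (0 : ℝ) ≤ ((X % q : ℕ) : ℝ) := Nat.cast_nonneg _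
  have h5 : (X : ℝ) / q = (X / q : ℕ) + ((X % q : ℕ) : ℝ) / q := by
    rw [div_eq_iff hq'.ne', add_mul, div_mul_cancel₀ _ hq'.ne', mul_comm]
    exact h2
  have h6 : ((X % q : ℕ) : ℝ) / q < 1 := (div_lt_one hq').2 h3
  have h7 : 0 ≤ ((X % q : ℕ) : ℝ) / q := by positivity
  rw [h5, abs_le]
  push_cast
  split_ifs <;> constructor <;> linarith

/-- `f` is the indicator, with multiplicity, of `n` residue classes modulo `q`. -/
def IsResidueSum (q n : ℕ) (f : ℕ → ℝ) : Prop :=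
  ∃ R : Multiset ℕ, R.card = n ∧
    ∀ m, f m = (R.map fun r => if m ≡ r [MOD q] then (1 : ℝ) else 0).sum

/-- By the Chinese remainder theorem, two classes to coprime moduli meet in one class. With
multisets the cardinalities multiply without an injectivity check. -/
theorem IsResidueSum.mul {q₁ q₂ n₁ n₂ : ℕ} {f₁ f₂ : ℕ → ℝ} (h : q₁.Coprime q₂)
    (h₁ : IsResidueSum q₁ n₁ f₁) (h₂ : IsResidueSum q₂ n₂ f₂) :
    IsResidueSum (q₁ * q₂) (n₁ * n₂) (fun m => f₁ m * f₂ m) := by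
  obtain ⟨R₁, hR₁, hf₁⟩ := h₁
  obtain ⟨R₂, hR₂, hf₂⟩ := h₂
  refine ⟨(R₁ ×ˢ R₂).map fun rs => (Nat.chineseRemainder h rs.1 rs.2 : ℕ), ?_, fun m => ?_⟩
  · rw [Multiset.card_map, Multiset.card_product, hR₁, hR₂]
  · simp only [hf₁, hf₂, Multiset.map_map]
    have : ((fun r => if m ≡ r [MOD q₁ * q₂] then (1 : ℝ) else 0) ∘
        fun rs : ℕ × ℕ => (Nat.chineseRemainder h rs.1 rs.2 : ℕ)) =
        fun rs => (if m ≡ rs.1 [MOD q₁] then (1 : ℝ) else 0) *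
          (if m ≡ rs.2 [MOD q₂] then (1 : ℝ) else 0) := by
      funext rs
      obtain ⟨hc1, hc2⟩ := (Nat.chineseRemainder h rs.1 rs.2).2
      simp only [Function.comp]
      rw [mul_ite, mul_one, mul_zero, ← ite_and]
      refine if_congr ?_ rfl rfl
      rw [← Nat.modEq_and_modEq_iff_modEq_mul h]
      exact ⟨fun hh => ⟨hh.2.trans hc2, hh.1.trans hc1⟩,
        fun hh => ⟨hh.2.trans hc1.symm, hh.1.trans hc2.symm⟩⟩
    rw [this, show R₁ ×ˢ R₂ = R₁.bind fun a => R₂.map (Prod.mk a) from rfl, Multiset.map_bind,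
      Multiset.sum_bind, ← Multiset.sum_map_mul_right]
    simp only [Multiset.map_map, Function.comp_def]
    exact congrArg _ (Multiset.map_congr rfl fun a _ => Multiset.sum_map_mul_left.symm)

theorem IsResidueSum.abs_sum_sub_le {q n : ℕ} {f : ℕ → ℝ} (hq : 0 < q) (h : IsResidueSum q n f)
    (X : ℕ) : |∑ m ∈ range X, f m - X * ((n : ℝ) / q)| ≤ n := by
  obtain ⟨R, rfl, hf⟩ := h
  simp_rw [hf]
  clear hf
  induction R using Multiset.induction_on with
  | empty => simp
  | cons r R ih =>
    simp only [Multiset.map_cons, Multiset.sum_cons, Multiset.card_cons, sum_add_distrib]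
    have h1 := abs_sum_modEq_sub_le X r hq
    push_cast
    have h2 : (X : ℝ) * ((R.card + 1 : ℝ) / q) = X * ((R.card : ℝ) / q) + X / q := by ring
    rw [h2]
    rw [abs_le] at *
    constructor <;> linarith [h1.1, h1.2, ih.1, ih.2]

/-- `(p - 1) * i` represents `-i` modulo `p` within the natural numbers. -/
theorem dvd_add_iff_modEq {p : ℕ} (hp : 0 < p) (m i : ℕ) :
    p ∣ m + i ↔ m ≡ (p - 1) * i [MOD p] := by
  have h0 : (p - 1) * i + i = p * i := by
    obtain ⟨q, rfl⟩ := Nat.exists_eq_succ_of_ne_zero hp.ne'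
    simp; ring
  have h1 : (p - 1) * i + i ≡ 0 [MOD p] := by
    rw [h0]; exact (Nat.modEq_zero_iff_dvd).2 (dvd_mul_right _ _)
  rw [← Nat.modEq_zero_iff_dvd]
  exact ⟨fun h => Nat.ModEq.add_right_cancel' i (h.trans h1.symm), fun h => (h.add_right i).trans h1⟩

theorem isResidueSum_pairDvd (i j : ℕ) {p : ℕ} (hp : 0 < p) :
    IsResidueSum p (pairRoots i j p) (fun m => pairDvd i j m p) := by
  unfold pairRoots
  split_ifs with h
  · refine ⟨{(p - 1) * i}, rfl, fun m => ?_⟩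
    simp only [Multiset.map_singleton, Multiset.sum_singleton, pairDvd]
    refine if_congr ?_ rfl rfl
    have h2 : p ∣ m + j ↔ p ∣ m + i := by
      rw [← Nat.modEq_zero_iff_dvd, ← Nat.modEq_zero_iff_dvd]
      exact ⟨fun hh => (h.add_left m).trans hh, fun hh => (h.add_left m).symm.trans hh⟩
    rw [h2, or_self, dvd_add_iff_modEq hp]
  · refine ⟨{(p - 1) * i, (p - 1) * j}, rfl, fun m => ?_⟩
    simp only [Multiset.insert_eq_cons, Multiset.map_cons, Multiset.map_singleton,
      Multiset.sum_cons, Multiset.sum_singleton, pairDvd]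
    rw [← if_congr (dvd_add_iff_modEq hp m i) rfl rfl, ← if_congr (dvd_add_iff_modEq hp m j) rfl rfl]
    have h2 : ¬ (p ∣ m + i ∧ p ∣ m + j) := by
      rintro ⟨h1, h2⟩
      rw [← Nat.modEq_zero_iff_dvd] at h1 h2
      exact h (Nat.ModEq.add_left_cancel' m (h1.trans h2.symm))
    by_cases h3 : p ∣ m + i <;> by_cases h4 : p ∣ m + j <;> simp_all

theorem isResidueSum_prod_pairDvd (i j : ℕ) {S : Finset ℕ} (hS : ∀ p ∈ S, p.Prime) :
    IsResidueSum (∏ p ∈ S, p) (∏ p ∈ S, pairRoots i j p) (fun m => ∏ p ∈ S, pairDvd i j m p) := by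
  induction S using Finset.induction_on with
  | empty => exact ⟨{0}, rfl, fun m => by simp [Nat.modEq_one]⟩
  | insert a S ha ih =>
    simp only [prod_insert ha]
    have hap := hS a (mem_insert_self a S)
    have hSp : ∀ p ∈ S, p.Prime := fun p hp => hS p (mem_insert_of_mem hp)
    refine (isResidueSum_pairDvd i j hap.pos).mul ?_ (ih hSp)
    refine Nat.Coprime.prod_right fun p hp => (Nat.coprime_primes hap (hSp p hp)).2 ?_
    rintro rfl
    exact ha hp

theorem pairRoots_le (i j p : ℕ) : pairRoots i j p ≤ 2 := by
  unfold pairRoots; split_ifs <;> simp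

theorem one_le_pairRoots (i j p : ℕ) : 1 ≤ pairRoots i j p := by
  unfold pairRoots; split_ifs <;> simp

/-- Each residue class costs an error of at most 1, and there are at most `2 ^ S.card` of them: this
is the origin of the weight 2^ω in Ψ_ω. -/
theorem abs_sum_prod_pairDvd_sub_le (i j X : ℕ) {S : Finset ℕ} (hS : ∀ p ∈ S, p.Prime) :
    |∑ m ∈ range X, ∏ p ∈ S, pairDvd i j m p - X * ∏ p ∈ S, ((pairRoots i j p : ℝ) / p)| ≤
      2 ^ S.card := by
  have h := (isResidueSum_prod_pairDvd i j hS).abs_sum_sub_le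
    (prod_pos fun p hp => (hS p hp).pos) X
  push_cast at h
  rw [← prod_div_distrib] at h
  refine h.trans ?_
  rw [← prod_const]
  refine prod_le_prod (fun _ _ => Nat.cast_nonneg _) fun p _ => ?_
  exact_mod_cast pairRoots_le i j p

theorem alphaSifted_eq_prod (y n : ℕ) :
    alphaSifted y n = ∏ p ∈ primesUpTo y, (1 - if p ∣ n then (1 : ℝ) else 0) := by
  unfold alphaSifted
  split_ifs with h
  · symm
    refine prod_eq_one fun p hp => ?_
    rw [mem_primesUpTo] at hp
    rw [if_neg, sub_zero]
    intro hd
    exact absurd (h p hp.1 hd) (by omega)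
  · push Not at h
    obtain ⟨p, hp, hd, hy⟩ := h
    symm
    exact prod_eq_zero (mem_primesUpTo.2 ⟨hp, hy⟩) (by rw [if_pos hd, sub_self])

theorem alphaSifted_mul_alphaSifted (y m i j : ℕ) :
    alphaSifted y (m + i) * alphaSifted y (m + j) =
      ∏ p ∈ primesUpTo y, (1 - pairDvd i j m p) := by
  rw [alphaSifted_eq_prod, alphaSifted_eq_prod, ← prod_mul_distrib]
  refine prod_congr rfl fun p _ => ?_
  unfold pairDvd
  by_cases h3 : p ∣ m + i <;> by_cases h4 : p ∣ m + j <;> simp [h3, h4]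

/-! ### Chebyshev bounds for sums of 1/p -/

/-- The product of these primes is at most the primorial of `2 ^ (i + 1)`, hence at most `4 ^ 2 ^ (i
+ 1)`. So there are at most `4 * 2 ^ i / i` of them. -/
theorem sum_inv_primes_dyadic_le {i : ℕ} (hi : 1 ≤ i) :
    ∑ p ∈ (Ico (2 ^ i) (2 ^ (i + 1))).filter Nat.Prime, (1 : ℝ) / p ≤ 4 / i := by
  set B := (Ico (2 ^ i) (2 ^ (i + 1))).filter Nat.Prime with hB
  have h1 : (2 ^ i) ^ B.card ≤ 4 ^ (2 ^ (i + 1)) := by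
    calc (2 ^ i) ^ B.card = ∏ p ∈ B, 2 ^ i := by rw [prod_const]
      _ ≤ ∏ p ∈ B, p := prod_le_prod' fun p hp => by
          rw [hB, mem_filter, mem_Ico] at hp; exact hp.1.1
      _ ≤ primorial (2 ^ (i + 1)) := by
          rw [primorial]
          refine prod_le_prod_of_subset_of_one_le' ?_ ?_
          · intro p hp
            rw [hB, mem_filter, mem_Ico] at hp
            simp only [mem_filter, mem_range]
            exact ⟨by omega, hp.2⟩
          · intro p hp _
            exact (mem_filter.1 hp).2.one_lt.le
      _ ≤ _ := primorial_le_four_pow _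
  have h2 : i * B.card ≤ 4 * 2 ^ i := by
    rw [← pow_mul, show (4 : ℕ) = 2 ^ 2 by norm_num, ← pow_mul] at h1
    have := (Nat.pow_le_pow_iff_right (by norm_num : 1 < 2)).1 h1
    rw [pow_succ] at this
    linarith
  have hi' : (0 : ℝ) < i := by exact_mod_cast hi
  have h2' : (i : ℝ) * B.card ≤ 4 * 2 ^ i := by exact_mod_cast h2
  calc ∑ p ∈ B, (1 : ℝ) / p ≤ ∑ p ∈ B, (1 : ℝ) / 2 ^ i := by
        refine sum_le_sum fun p hp => ?_
        rw [hB, mem_filter, mem_Ico] at hp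
        have : (2 : ℝ) ^ i ≤ p := by exact_mod_cast hp.1.1
        gcongr
    _ = B.card / 2 ^ i := by rw [sum_const, nsmul_eq_mul]; ring
    _ ≤ 4 / i := by
        rw [div_le_div_iff₀ (by positivity) hi']
        linarith

/-- With `a = log₂ x`, the range is covered by `a + 2` dyadic blocks, each contributing at most `4 /
a`. -/
theorem sum_inv_primes_sq_le {x : ℕ} (hx : 2 ≤ x) :
    ∑ p ∈ (Ico x (x ^ 2)).filter Nat.Prime, (1 : ℝ) / p ≤ 12 := by
  set a := Nat.log 2 x with ha
  have ha1 : 1 ≤ a := Nat.log_pos (by norm_num) hx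
  have hle : 2 ^ a ≤ x := Nat.pow_log_le_self 2 (by omega)
  have hlt : x < 2 ^ (a + 1) := Nat.lt_pow_succ_log_self (by norm_num) x
  have ha' : (1 : ℝ) ≤ a := by exact_mod_cast ha1
  have hsub : (Ico x (x ^ 2)).filter Nat.Prime ⊆ (Ico a (2 * a + 2)).biUnion
      fun i => (Ico (2 ^ i) (2 ^ (i + 1))).filter Nat.Prime := by
    intro p hp
    rw [mem_filter, mem_Ico] at hp
    obtain ⟨⟨h1, h2⟩, h3⟩ := hp
    rw [mem_biUnion]
    refine ⟨Nat.log 2 p, ?_, ?_⟩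
    · rw [mem_Ico]
      refine ⟨Nat.log_mono_right h1, ?_⟩
      refine Nat.log_lt_of_lt_pow h3.ne_zero ?_
      calc p < x ^ 2 := h2
        _ ≤ (2 ^ (a + 1)) ^ 2 := Nat.pow_le_pow_left hlt.le 2
        _ = _ := by rw [← pow_mul]; ring_nf
    · rw [mem_filter, mem_Ico]
      exact ⟨⟨Nat.pow_log_le_self 2 h3.ne_zero, Nat.lt_pow_succ_log_self (by norm_num) p⟩, h3⟩
  calc ∑ p ∈ (Ico x (x ^ 2)).filter Nat.Prime, (1 : ℝ) / p
      ≤ ∑ p ∈ (Ico a (2 * a + 2)).biUnion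
          fun i => (Ico (2 ^ i) (2 ^ (i + 1))).filter Nat.Prime, (1 : ℝ) / p :=
        sum_le_sum_of_subset_of_nonneg hsub fun _ _ _ => by positivity
    _ ≤ ∑ i ∈ Ico a (2 * a + 2), ∑ p ∈ (Ico (2 ^ i) (2 ^ (i + 1))).filter Nat.Prime, (1 : ℝ) / p := by
        rw [sum_biUnion]
        intro i _ j _ hij
        rw [Function.onFun, disjoint_left]
        intro p hp hq
        rw [mem_filter, mem_Ico] at hp hq
        apply hij
        have e1 := Nat.log_eq_of_pow_le_of_lt_pow hp.1.1 hp.1.2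
        have e2 := Nat.log_eq_of_pow_le_of_lt_pow hq.1.1 hq.1.2
        omega
    _ ≤ ∑ i ∈ Ico a (2 * a + 2), (4 : ℝ) / a := by
        refine sum_le_sum fun i hi => ?_
        rw [mem_Ico] at hi
        refine (sum_inv_primes_dyadic_le (by omega)).trans ?_
        have : (a : ℝ) ≤ i := by exact_mod_cast hi.1
        gcongr
    _ = (a + 2) * (4 / a) := by
        rw [sum_const, Nat.card_Ico, nsmul_eq_mul, show 2 * a + 2 - a = a + 2 by omega]
        push_cast; ring
    _ ≤ 12 := by
        rw [← mul_div_assoc, div_le_iff₀ (by linarith)]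
        linarith

theorem sum_inv_primes_pow_le {x : ℕ} (hx : 2 ≤ x) (k : ℕ) :
    ∑ p ∈ (Ico x (x ^ 2 ^ k)).filter Nat.Prime, (1 : ℝ) / p ≤ 12 * k := by
  induction k with
  | zero => simp
  | succ k ih =>
    have h2 : 2 ≤ x ^ 2 ^ k := hx.trans (Nat.le_self_pow (by positivity) x)
    have hsub : (Ico x (x ^ 2 ^ (k + 1))).filter Nat.Prime ⊆
        (Ico x (x ^ 2 ^ k)).filter Nat.Prime ∪
          (Ico (x ^ 2 ^ k) ((x ^ 2 ^ k) ^ 2)).filter Nat.Prime := by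
      intro p hp
      rw [pow_succ, pow_mul] at hp
      simp only [mem_filter, mem_Ico, mem_union] at *
      by_cases h : p < x ^ 2 ^ k
      · exact Or.inl ⟨⟨hp.1.1, h⟩, hp.2⟩
      · exact Or.inr ⟨⟨by omega, hp.1.2⟩, hp.2⟩
    have h3 := sum_inv_primes_sq_le h2
    calc _ ≤ ∑ p ∈ (Ico x (x ^ 2 ^ k)).filter Nat.Prime ∪
          (Ico (x ^ 2 ^ k) ((x ^ 2 ^ k) ^ 2)).filter Nat.Prime, (1 : ℝ) / p :=
          sum_le_sum_of_subset_of_nonneg hsub fun _ _ _ => by positivity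
      _ ≤ ∑ p ∈ (Ico x (x ^ 2 ^ k)).filter Nat.Prime, (1 : ℝ) / p +
          ∑ p ∈ (Ico (x ^ 2 ^ k) ((x ^ 2 ^ k) ^ 2)).filter Nat.Prime, (1 : ℝ) / p := by
          rw [← sum_union_inter]
          exact le_add_of_nonneg_right (sum_nonneg fun _ _ => by positivity)
      _ ≤ _ := by push_cast; linarith

theorem sum_inv_primes_le_of_forall_lt_pow {A : Finset ℕ} (hA : ∀ p ∈ A, p.Prime) (k : ℕ)
    (h : ∀ p ∈ A, ∀ q ∈ A, q < p ^ 2 ^ k) : ∑ p ∈ A, (1 : ℝ) / p ≤ 12 * k := by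
  rcases A.eq_empty_or_nonempty with rfl | hne
  · simp
  · have hm := A.min'_mem hne
    refine le_trans (sum_le_sum_of_subset_of_nonneg (fun q hq => ?_) fun _ _ _ => by positivity)
      (sum_inv_primes_pow_le (hA _ hm).two_le k)
    rw [mem_filter, mem_Ico]
    exact ⟨⟨A.min'_le q hq, h _ hm q hq⟩, hA q hq⟩

/-- Turns bounds for ∑ 1/p into lower bounds for sieve products. Two roots at `p = 2` must be
excluded, since that factor vanishes. -/
theorem exp_neg_le_one_sub {p : ℕ} (hp : p.Prime) {ν : ℕ} (hν : ν ≤ 2) (h2 : p = 2 → ν ≤ 1) :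
    Real.exp (-(4 * (1 / p))) ≤ 1 - (ν : ℝ) / p := by
  have hp0 : (0 : ℝ) < p := by exact_mod_cast hp.pos
  rw [Real.exp_neg, inv_le_comm₀ (Real.exp_pos _)]
  · rcases hp.two_le.eq_or_lt with h | h
    · have hν1 : (ν : ℝ) ≤ 1 := by exact_mod_cast h2 h.symm
      rw [← h]
      have h1 : (1 - (ν : ℝ) / (2 : ℕ))⁻¹ ≤ 2 := by
        rw [inv_le_comm₀ (by push_cast; linarith) (by norm_num)]
        push_cast; linarith
      have h3 := Real.add_one_le_exp (4 * (1 / ((2 : ℕ) : ℝ)))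
      push_cast at *
      linarith
    · have hp3 : (3 : ℝ) ≤ p := by exact_mod_cast h
      have hν2 : (ν : ℝ) ≤ 2 := by exact_mod_cast hν
      have h1 : (1 - (ν : ℝ) / p)⁻¹ ≤ p / (p - 2) := by
        have : p / (p - 2) = (1 - (2 : ℝ) / p)⁻¹ := by
          rw [one_sub_div hp0.ne', inv_div]
        rw [this]
        apply inv_anti₀
        · rw [sub_pos, div_lt_one hp0]; linarith
        · gcongr
      refine h1.trans ?_
      -- The linear bound for the exponential would fail at `p = 3`.
      have h3 := Real.quadratic_le_exp_of_nonneg (x := 4 * (1 / (p : ℝ))) (by positivity)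
      refine le_trans ?_ h3
      rw [div_le_iff₀ (by linarith)]
      have e : (1 + 4 * (1 / (p : ℝ)) + (4 * (1 / (p : ℝ))) ^ 2 / 2) * (p - 2) =
          p + 2 - 16 / p ^ 2 := by field_simp; ring
      rw [e]
      have : 16 / (p : ℝ) ^ 2 ≤ 2 := by
        rw [div_le_iff₀ (by positivity)]; nlinarith
      linarith
  · rw [sub_pos, div_lt_one hp0]
    rcases hp.two_le.eq_or_lt with h | h
    · have := h2 h.symm
      exact_mod_cast (by omega : ν < p)
    · exact_mod_cast (by omega : ν < p)

/-! ### Blocks of primes and the level of the sieve -/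

/-- The block of a prime `p`: the `j` with `p ^ K ^ j ≤ y < p ^ K ^ (j + 1)`. -/
def primeBlock (y K p : ℕ) : ℕ := Nat.log K (Nat.log p y)

theorem pow_primeBlock_le {y K p : ℕ} (hp : p.Prime) (hpy : p ≤ y) :
    p ^ K ^ primeBlock y K p ≤ y := by
  have h1 : Nat.log p y ≠ 0 := (Nat.log_pos hp.one_lt hpy).ne'
  calc p ^ K ^ primeBlock y K p ≤ p ^ Nat.log p y :=
        Nat.pow_le_pow_right hp.pos (Nat.pow_log_le_self K h1)
    _ ≤ y := Nat.pow_log_le_self p (by have := hp.pos; omega)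

theorem lt_pow_primeBlock_succ {y K p : ℕ} (hK : 1 < K) (hp : p.Prime) :
    y < p ^ K ^ (primeBlock y K p + 1) :=
  lt_of_lt_of_le (Nat.lt_pow_succ_log_self hp.one_lt y)
    (Nat.pow_le_pow_right hp.pos (Nat.lt_pow_succ_log_self hK _))

/-- If `p` and `q` share the block `j`, then `q ^ K ^ j ≤ y < p ^ K ^ (j + 1)`, so `q < p ^ K` with
`K = 2 ^ k`: the block spans at most `k` squarings. -/
theorem sum_inv_primeBlock_le (y k j : ℕ) (hk : 1 ≤ k) :
    ∑ p ∈ (primesUpTo y).filter (fun p => primeBlock y (2 ^ k) p = j), (1 : ℝ) / p ≤ 12 * k := by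
  refine sum_inv_primes_le_of_forall_lt_pow (fun p hp => ?_) k fun p hp q hq => ?_
  · exact (mem_primesUpTo.1 (mem_filter.1 hp).1).1
  · rw [mem_filter, mem_primesUpTo] at hp hq
    have h1 := pow_primeBlock_le (K := 2 ^ k) hq.1.1 hq.1.2
    have h2 := lt_pow_primeBlock_succ (y := y) (Nat.one_lt_two_pow (by omega : k ≠ 0)) hp.1.1
    rw [hq.2] at h1
    rw [hp.2, pow_succ, mul_comm, pow_mul] at h2
    exact lt_of_pow_lt_pow_left₀ _ (Nat.zero_le _) (h1.trans_lt h2)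

theorem primeBlock_lt (y K p : ℕ) : primeBlock y K p < y + 1 := by
  have h1 : primeBlock y K p ≤ Nat.log p y := Nat.log_le_self _ _
  have h2 : Nat.log p y ≤ y := Nat.log_le_self _ _
  omega

theorem sum_range_div_two_pow_le (t : ℕ) : ∑ j ∈ range t, (j : ℝ) * (1 / 2) ^ j ≤ 2 := by
  have h : ∑ j ∈ range t, (j : ℝ) * (1 / 2) ^ j = 2 - 2 * (t + 1) * (1 / 2) ^ t := by
    induction t with
    | zero => simp
    | succ t ih => rw [sum_range_succ, ih, pow_succ]; push_cast; ring
  have : 0 ≤ 2 * ((t : ℝ) + 1) * (1 / 2) ^ t := by positivity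
  linarith

theorem geom_sum_le_one_add {r : ℝ} (h0 : 0 ≤ r) (h1 : r ≤ 1 / 2) (t : ℕ) :
    ∑ j ∈ range t, r ^ j ≤ 1 + 2 * r := by
  have h := mul_neg_geom_sum r t
  have h2 : 0 ≤ r ^ t := by positivity
  have h3 : 0 ≤ ∑ j ∈ range t, r ^ j := sum_nonneg fun _ _ => by positivity
  nlinarith

theorem sum_primeBlock_weights_le (k n t : ℕ) (hk : 1 ≤ k) :
    ∑ j ∈ range t, ((n : ℝ) + 2 * j) * (1 / 2 ^ k) ^ j ≤ n * (1 + 2 / 2 ^ k) + 4 := by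
  have hr : (1 : ℝ) / 2 ^ k ≤ 1 / 2 := by
    have : (2 : ℝ) ^ 1 ≤ 2 ^ k := pow_le_pow_right₀ (by norm_num) hk
    rw [pow_one] at this
    gcongr
  have h1 := geom_sum_le_one_add (by positivity) hr t
  have h2 : ∑ j ∈ range t, (j : ℝ) * (1 / 2 ^ k) ^ j ≤ 2 :=
    (sum_le_sum fun j _ => by gcongr).trans (sum_range_div_two_pow_le t)
  calc ∑ j ∈ range t, ((n : ℝ) + 2 * j) * (1 / 2 ^ k) ^ j
      = n * ∑ j ∈ range t, (1 / 2 ^ k : ℝ) ^ j + 2 * ∑ j ∈ range t, (j : ℝ) * (1 / 2 ^ k) ^ j := by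
        rw [mul_sum, mul_sum, ← sum_add_distrib]
        exact sum_congr rfl fun j _ => by ring
    _ ≤ n * (1 + 2 * (1 / 2 ^ k)) + 2 * 2 := by gcongr
    _ = _ := by ring

/-- Block `j` holds at most `n + 2 * j` primes of `S`, each at most `y` to the power `1 / 2 ^ (k *
j)`. The exponents sum geometrically, so for large `k` the level is barely more than `n`. -/
theorem prod_le_rpow_of_isBlockAdmissible {y k n : ℕ} {u : ℝ} (hy : 2 ≤ y) (hk : 1 ≤ k)
    (hu : n * (1 + 2 / 2 ^ k) + 4 ≤ u) {S : Finset ℕ} (hS : S ⊆ primesUpTo y)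
    (hadm : IsBlockAdmissible (primeBlock y (2 ^ k)) (fun j => n + 2 * j) (y + 1) S) :
    ((∏ p ∈ S, p : ℕ) : ℝ) ≤ (y : ℝ) ^ u := by
  have hy0 : (0 : ℝ) < y := by exact_mod_cast (by omega : 0 < y)
  have hly : 0 ≤ Real.log y := Real.log_nonneg (by exact_mod_cast (by omega : 1 ≤ y))
  have hSp : ∀ p ∈ S, p.Prime ∧ p ≤ y := fun p hp => mem_primesUpTo.1 (hS hp)
  have hpos : (0 : ℝ) < ((∏ p ∈ S, p : ℕ) : ℝ) := by
    exact_mod_cast prod_pos fun p hp => (hSp p hp).1.pos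
  rw [Real.le_rpow_iff_log_le hpos hy0]
  push_cast
  rw [Real.log_prod fun p hp => by exact_mod_cast (hSp p hp).1.ne_zero]
  set J := primeBlock y (2 ^ k) with hJ
  have hlog : ∀ p ∈ S, Real.log p ≤ (1 / 2 ^ k) ^ J p * Real.log y := by
    intro p hp
    have hp0 : (0 : ℝ) < p := by exact_mod_cast (hSp p hp).1.pos
    have h1 : ((p : ℝ)) ^ (2 ^ k) ^ J p ≤ y := by
      exact_mod_cast pow_primeBlock_le (K := 2 ^ k) (hSp p hp).1 (hSp p hp).2
    have h2 := Real.log_le_log (by positivity) h1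
    rw [Real.log_pow] at h2
    rw [div_pow, one_pow, div_mul_eq_mul_div, one_mul, le_div_iff₀ (by positivity)]
    push_cast at h2
    linarith
  have hfib : ∑ p ∈ S, (1 / 2 ^ k : ℝ) ^ J p =
      ∑ j ∈ range (y + 1), (S.filter (fun p => J p = j)).card * (1 / 2 ^ k : ℝ) ^ j := by
    rw [← sum_fiberwise_of_maps_to (t := range (y + 1)) (g := J)
      (fun p _ => mem_range.2 (primeBlock_lt y _ p))]
    refine sum_congr rfl fun j _ => ?_
    rw [sum_congr rfl (g := fun _ => (1 / 2 ^ k : ℝ) ^ j)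
      (fun p hp => by rw [(mem_filter.1 hp).2]), sum_const, nsmul_eq_mul]
  obtain ⟨l, hl⟩ := hadm
  calc ∑ p ∈ S, Real.log p ≤ ∑ p ∈ S, (1 / 2 ^ k) ^ J p * Real.log y := sum_le_sum hlog
    _ = (∑ j ∈ range (y + 1), (S.filter (fun p => J p = j)).card * (1 / 2 ^ k : ℝ) ^ j) *
          Real.log y := by rw [← sum_mul, hfib]
    _ ≤ (∑ j ∈ range (y + 1), ((n : ℝ) + 2 * j) * (1 / 2 ^ k : ℝ) ^ j) * Real.log y := by
        gcongr with j hj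
        exact_mod_cast (hl j (mem_range.1 hj)).1
    _ ≤ u * Real.log y := by
        gcongr
        exact (sum_primeBlock_weights_le k n (y + 1) hk).trans hu

theorem sum_two_pow_card_le_friableOmegaSum {y : ℕ} {x : ℝ} {𝒮 : Finset (Finset ℕ)}
    (h𝒮 : ∀ S ∈ 𝒮, S ⊆ primesUpTo y ∧ ((∏ p ∈ S, p : ℕ) : ℝ) ≤ x) :
    ∑ S ∈ 𝒮, (2 : ℝ) ^ S.card ≤ friableOmegaSum x y := by
  have hpr : ∀ S ∈ 𝒮, ∀ p ∈ S, p.Prime := fun S hS p hp =>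
    (mem_primesUpTo.1 ((h𝒮 S hS).1 hp)).1
  have hpf : ∀ S ∈ 𝒮, (∏ p ∈ S, p).primeFactors = S := fun S hS =>
    Nat.primeFactors_prod (hpr S hS)
  have hsq : ∀ S ∈ 𝒮, Squarefree (∏ p ∈ S, p) := by
    intro S hS
    refine Finset.squarefree_prod_of_pairwise_isCoprime ?_ fun p hp => (hpr S hS p hp).prime.squarefree
    intro p hp q hq hpq
    exact Nat.coprime_iff_isRelPrime.1
      ((Nat.coprime_primes (hpr S hS p hp) (hpr S hS q hq)).2 hpq)
  have hinj : Set.InjOn (fun S : Finset ℕ => ∏ p ∈ S, p) 𝒮 := by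
    intro S hS S' hS' h
    rw [← hpf S hS, ← hpf S' hS']
    exact congrArg Nat.primeFactors h
  unfold friableOmegaSum
  calc ∑ S ∈ 𝒮, (2 : ℝ) ^ S.card
      = ∑ n ∈ 𝒮.image (fun S : Finset ℕ => ∏ p ∈ S, p),
          (2 : ℝ) ^ (ArithmeticFunction.cardDistinctFactors n) *
            ((ArithmeticFunction.moebius n : ℤ) : ℝ) ^ 2 := by
        rw [sum_image hinj]
        refine sum_congr rfl fun S hS => ?_
        have h1 : ((ArithmeticFunction.moebius (∏ p ∈ S, p) : ℤ) : ℝ) ^ 2 = 1 := by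
          exact_mod_cast ArithmeticFunction.moebius_sq_eq_one_of_squarefree (hsq S hS)
        rw [h1, mul_one, ArithmeticFunction.cardDistinctFactors_apply, ← List.card_toFinset]
        congr 2
        exact (hpf S hS).symm
    _ ≤ _ := by
        refine sum_le_sum_of_subset_of_nonneg ?_ fun _ _ _ => by positivity
        intro n hn
        obtain ⟨S, hS, rfl⟩ := mem_image.1 hn
        rw [mem_filter, mem_Icc]
        refine ⟨⟨Nat.one_le_iff_ne_zero.2 (hsq S hS).ne_zero, Nat.le_floor (h𝒮 S hS).2⟩, ?_⟩
        rw [hpf S hS]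
        exact fun p hp => (mem_primesUpTo.1 ((h𝒮 S hS).1 hp)).2

/-- Since `n! (2j)!` divides `(n + 2j)!`, the errors of all blocks together cost only a factor `exp
L` over that of block 0, whatever the number of blocks. -/
theorem sum_pow_div_factorial_le {L : ℝ} (hL : 0 ≤ L) (n t : ℕ) :
    ∑ j ∈ range t, L ^ (n + 2 * j) / (n + 2 * j).factorial ≤
      L ^ n / n.factorial * Real.exp L := by
  have h1 : ∀ j ∈ range t, L ^ (n + 2 * j) / (n + 2 * j).factorial ≤
      L ^ n / n.factorial * (L ^ (2 * j) / (2 * j).factorial) := by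
    intro j _
    have h : ((n.factorial * (2 * j).factorial : ℕ) : ℝ) ≤ (n + 2 * j).factorial := by
      exact_mod_cast Nat.le_of_dvd (Nat.factorial_pos _)
        (Nat.factorial_mul_factorial_dvd_factorial_add _ _)
    have hf1 : (0 : ℝ) < n.factorial := by exact_mod_cast n.factorial_pos
    have hf2 : (0 : ℝ) < (2 * j).factorial := by exact_mod_cast (2 * j).factorial_pos
    push_cast at h
    rw [div_mul_div_comm, ← pow_add]
    gcongr
  refine (sum_le_sum h1).trans ?_
  rw [← mul_sum]
  gcongr
  refine le_trans ?_ (Real.sum_le_exp_of_nonneg hL (2 * t))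
  rw [← sum_image (s := range t) (g := fun j => 2 * j) (f := fun i => L ^ i / (i.factorial : ℝ))
    (fun a _ b _ h => by simpa using h)]
  refine sum_le_sum_of_subset_of_nonneg ?_ fun _ _ _ => by positivity
  intro i hi
  obtain ⟨j, hj, rfl⟩ := mem_image.1 hi
  rw [mem_range] at *
  omega

theorem pairRoots_div_mem {p : ℕ} (hp : p.Prime) (i j : ℕ) :
    0 ≤ (pairRoots i j p : ℝ) / p ∧ (pairRoots i j p : ℝ) / p ≤ 1 := by
  have hp0 : (0 : ℝ) < p := by exact_mod_cast hp.pos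
  refine ⟨by positivity, (div_le_one hp0).2 ?_⟩
  exact_mod_cast (pairRoots_le i j p).trans hp.two_le

theorem pairDvd_mem (i j m p : ℕ) : 0 ≤ pairDvd i j m p ∧ pairDvd i j m p ≤ 1 := by
  unfold pairDvd; split_ifs <;> simp

/-! ### The fundamental lemma for pairs -/

/-- The relative error of the sieve with blocks of ratio `2 ^ k` and truncation parameter `n`. -/
noncomputable def sieveError (k n : ℕ) : ℝ :=
  Real.exp (72 * k) * ((24 * k : ℝ) ^ n / n.factorial)

theorem abs_sum_pair_sub_le {y k n : ℕ} {u : ℝ} (hy : 2 ≤ y) (hk : 1 ≤ k) (hn : Odd n)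
    (hu : n * (1 + 2 / 2 ^ k) + 4 ≤ u) {i j : ℕ} (hij : i ≡ j [MOD 2]) (X : ℕ) :
    |∑ m ∈ range X, alphaSifted y (m + i) * alphaSifted y (m + j) - X * pairDensity y i j| ≤
      2 * X * (pairDensity y i j * (sieveError k n * Real.exp (sieveError k n))) +
        friableOmegaSum ((y : ℝ) ^ u) y := by
  classical
  simp_rw [alphaSifted_mul_alphaSifted]
  set J := primeBlock y (2 ^ k) with hJ
  have hpr : ∀ p ∈ primesUpTo y, p.Prime := fun p hp => (mem_primesUpTo.1 hp).1
  have hJt : ∀ p ∈ primesUpTo y, J p < y + 1 := fun p _ => primeBlock_lt y _ p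
  have hodd : ∀ l, Odd (n + 2 * l) := fun l => hn.add_even (even_two_mul l)
  have hρ : ∀ p ∈ primesUpTo y, 0 ≤ (pairRoots i j p : ℝ) / p ∧ (pairRoots i j p : ℝ) / p ≤ 1 :=
    fun p hp => pairRoots_div_mem (hpr p hp) i j
  have hmain := brun_hooley (X := X) (x := pairDvd i j)
    (ρ := fun p => (pairRoots i j p : ℝ) / p) (M := fun S => 2 ^ S.card) hJt hodd
    (fun m p _ => pairDvd_mem i j m p) hρ (fun S => by positivity)
    (fun S hS => abs_sum_prod_pairDvd_sub_le i j X fun p hp => hpr p (hS hp))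
  -- With at most two roots per prime, a block has density sum at most `2 * 12k = 24k` and sieve
  -- product at least `exp (-4 * 12k)`. Summation over the blocks later adds `exp (24k)`, which
  -- gives the 72 in `sieveError`.
  have hN : ∀ l, cardWeightedSum (exactWeight (n + 2 * l))
      ((primesUpTo y).filter (fun p => J p = l)) (fun p => (pairRoots i j p : ℝ) / p) ≤
      (Real.exp (48 * k) * ((24 * k : ℝ) ^ (n + 2 * l) / (n + 2 * l).factorial)) *
        ∏ p ∈ (primesUpTo y).filter (fun p => J p = l), (1 - (pairRoots i j p : ℝ) / p) := by
    intro l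
    have hsum := sum_inv_primeBlock_le y k l hk
    have hprl : ∀ p ∈ (primesUpTo y).filter (fun p => J p = l), p.Prime :=
      fun p hp => hpr p (mem_filter.1 hp).1
    have h1 := cardWeightedSum_exactWeight_le ((primesUpTo y).filter (fun p => J p = l))
      (x := fun p => (pairRoots i j p : ℝ) / p) (fun p _ => by positivity) (n + 2 * l)
    have h2 : ∑ p ∈ (primesUpTo y).filter (fun p => J p = l), (pairRoots i j p : ℝ) / p ≤
        24 * k := by
      calc _ ≤ ∑ p ∈ (primesUpTo y).filter (fun p => J p = l), 2 * ((1 : ℝ) / p) := by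
            refine sum_le_sum fun p _ => ?_
            rw [mul_one_div]
            gcongr
            exact_mod_cast pairRoots_le i j p
        _ ≤ _ := by rw [← mul_sum]; linarith
    have h3 : Real.exp (-(48 * k)) ≤
        ∏ p ∈ (primesUpTo y).filter (fun p => J p = l), (1 - (pairRoots i j p : ℝ) / p) := by
      calc Real.exp (-(48 * k)) ≤ Real.exp (∑ p ∈ (primesUpTo y).filter (fun p => J p = l),
            -(4 * ((1 : ℝ) / p))) := by
            rw [Real.exp_le_exp, sum_neg_distrib, ← mul_sum]; linarith
        _ = ∏ p ∈ (primesUpTo y).filter (fun p => J p = l), Real.exp (-(4 * ((1 : ℝ) / p))) :=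
            Real.exp_sum _ _
        _ ≤ _ := by
            refine prod_le_prod (fun _ _ => (Real.exp_pos _).le) fun p hp => ?_
            refine exp_neg_le_one_sub (hprl p hp) (pairRoots_le i j p) ?_
            rintro rfl
            rw [pairRoots, if_pos hij]
    calc _ ≤ (∑ p ∈ (primesUpTo y).filter (fun p => J p = l), (pairRoots i j p : ℝ) / p) ^
            (n + 2 * l) / (n + 2 * l).factorial := h1
      _ ≤ (24 * k : ℝ) ^ (n + 2 * l) / (n + 2 * l).factorial := by gcongr
      _ = (Real.exp (48 * k) * ((24 * k : ℝ) ^ (n + 2 * l) / (n + 2 * l).factorial)) *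
            Real.exp (-(48 * k)) := by
          rw [Real.exp_neg]; field_simp
      _ ≤ _ := by gcongr
  have herr := brun_hooley_error_le hJt hodd hρ (fun l => by positivity) hN
  have hs : ∑ l ∈ range (y + 1),
      (Real.exp (48 * k) * ((24 * k : ℝ) ^ (n + 2 * l) / (n + 2 * l).factorial)) ≤
      sieveError k n := by
    rw [← mul_sum]
    have h := sum_pow_div_factorial_le (L := 24 * k) (by positivity) n (y + 1)
    calc _ ≤ Real.exp (48 * k) * ((24 * k : ℝ) ^ n / n.factorial * Real.exp (24 * k)) := by gcongr
      _ = _ := by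
          rw [sieveError, show (72 * k : ℝ) = 48 * k + 24 * k by ring, Real.exp_add]; ring
  have hs0 : 0 ≤ ∑ l ∈ range (y + 1),
      (Real.exp (48 * k) * ((24 * k : ℝ) ^ (n + 2 * l) / (n + 2 * l).factorial)) :=
    sum_nonneg fun _ _ => by positivity
  have hW : 0 ≤ ∏ p ∈ primesUpTo y, (1 - (pairRoots i j p : ℝ) / p) :=
    prod_nonneg fun p hp => by linarith [(hρ p hp).2]
  refine hmain.trans (add_le_add ?_ ?_)
  · refine mul_le_mul_of_nonneg_left (herr.trans ?_) (by positivity)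
    rw [pairDensity]
    gcongr
    exact hs0.trans hs
  · refine sum_two_pow_card_le_friableOmegaSum fun S hS => ?_
    rw [mem_filter, mem_powerset] at hS
    exact ⟨hS.1, prod_le_rpow_of_isBlockAdmissible hy hk hu hS.1 hS.2⟩

/-! ### Densities and monotonicity -/

theorem siftedDensity_eq (y : ℕ) : siftedDensity y = ∏ p ∈ primesUpTo y, (1 - 1 / (p : ℝ)) := rfl

theorem one_div_prime_le_half {p : ℕ} (hp : p.Prime) : 1 / (p : ℝ) ≤ 1 / 2 := by
  have : (2 : ℝ) ≤ p := by exact_mod_cast hp.two_le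
  gcongr

theorem siftedDensity_pos (y : ℕ) : 0 < siftedDensity y := by
  rw [siftedDensity_eq]
  exact prod_pos fun p hp => by linarith [one_div_prime_le_half (mem_primesUpTo.1 hp).1]

theorem siftedDensity_le_one (y : ℕ) : siftedDensity y ≤ 1 := by
  rw [siftedDensity_eq]
  refine prod_le_one (fun p hp => ?_) fun p _ => ?_
  · linarith [one_div_prime_le_half (mem_primesUpTo.1 hp).1]
  · have : 0 ≤ 1 / (p : ℝ) := by positivity
    linarith

theorem pairDensity_nonneg (y i j : ℕ) : 0 ≤ pairDensity y i j :=
  prod_nonneg fun p hp => by linarith [(pairRoots_div_mem (mem_primesUpTo.1 hp).1 i j).2]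

theorem pairDensity_le (y i j : ℕ) : pairDensity y i j ≤ siftedDensity y := by
  rw [siftedDensity_eq]
  refine prod_le_prod (fun p hp => ?_) fun p hp => ?_
  · linarith [(pairRoots_div_mem (mem_primesUpTo.1 hp).1 i j).2]
  · have : (1 : ℝ) ≤ pairRoots i j p := by exact_mod_cast one_le_pairRoots i j p
    gcongr

theorem pairDensity_self (y i : ℕ) : pairDensity y i i = siftedDensity y := by
  rw [siftedDensity_eq]
  refine prod_congr rfl fun p _ => ?_
  rw [pairRoots, if_pos (Nat.ModEq.refl i), Nat.cast_one]

theorem pairDensity_of_not_modEq {y i j : ℕ} (hy : 2 ≤ y) (h : ¬ i ≡ j [MOD 2]) :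
    pairDensity y i j = 0 := by
  refine prod_eq_zero (mem_primesUpTo.2 ⟨Nat.prime_two, hy⟩) ?_
  rw [pairRoots, if_neg h]; norm_num

theorem alphaSifted_nonneg (y n : ℕ) : 0 ≤ alphaSifted y n := by
  unfold alphaSifted; split_ifs <;> simp

theorem alphaSifted_le_one (y n : ℕ) : alphaSifted y n ≤ 1 := by
  unfold alphaSifted; split_ifs <;> simp

theorem alphaSifted_mul_self (y n : ℕ) : alphaSifted y n * alphaSifted y n = alphaSifted y n := by
  unfold alphaSifted; split_ifs <;> simp

theorem alphaSifted_anti {z y : ℕ} (h : z ≤ y) (n : ℕ) : alphaSifted y n ≤ alphaSifted z n := by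
  unfold alphaSifted
  split_ifs with h1 h2
  · rfl
  · exact absurd (fun p hp hd => lt_of_le_of_lt h (h1 p hp hd)) h2
  · simp
  · rfl

theorem alphaSifted_mul_eq_zero {y i j : ℕ} (hy : 2 ≤ y) (h : ¬ i ≡ j [MOD 2]) (m : ℕ) :
    alphaSifted y (m + i) * alphaSifted y (m + j) = 0 := by
  rw [alphaSifted_mul_alphaSifted]
  refine prod_eq_zero (mem_primesUpTo.2 ⟨Nat.prime_two, hy⟩) ?_
  rw [pairDvd, if_pos, sub_self]
  unfold Nat.ModEq at h
  omega

theorem friableOmegaSum_mono {x x' : ℝ} {y y' : ℕ} (hx : x ≤ x') (hy : y ≤ y') :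
    friableOmegaSum x y ≤ friableOmegaSum x' y' := by
  unfold friableOmegaSum
  refine sum_le_sum_of_subset_of_nonneg ?_ fun _ _ _ => by positivity
  intro n hn
  rw [mem_filter, mem_Icc] at *
  exact ⟨⟨hn.1.1, hn.1.2.trans (Nat.floor_mono hx)⟩, fun p hp => (hn.2 p hp).trans hy⟩

theorem friableOmegaSum_nonneg (x : ℝ) (y : ℕ) : 0 ≤ friableOmegaSum x y :=
  sum_nonneg fun _ _ => by positivity

/-- A weak Mertens estimate: from `z + 1` to `y` there are at most `a` squarings, each adding at
most 12 to ∑ 1/p. -/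
theorem siftedDensity_le_mul {z y a : ℕ} (hz : 1 ≤ z) (hzy : z ≤ y) (h : y < (z + 1) ^ 2 ^ a) :
    siftedDensity z ≤ Real.exp (48 * a) * siftedDensity y := by
  have hsub : primesUpTo z ⊆ primesUpTo y := fun p hp => by
    rw [mem_primesUpTo] at *; exact ⟨hp.1, hp.2.trans hzy⟩
  have hsum : ∑ p ∈ primesUpTo y \ primesUpTo z, (1 : ℝ) / p ≤ 12 * a := by
    refine le_trans (sum_le_sum_of_subset_of_nonneg ?_ fun _ _ _ => by positivity)
      (sum_inv_primes_pow_le (by omega : 2 ≤ z + 1) a)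
    intro p hp
    rw [mem_sdiff, mem_primesUpTo, mem_primesUpTo] at hp
    rw [mem_filter, mem_Ico]
    refine ⟨⟨?_, by omega⟩, hp.1.1⟩
    by_contra hc
    exact hp.2 ⟨hp.1.1, by omega⟩
  have hge : Real.exp (-(48 * a)) ≤ ∏ p ∈ primesUpTo y \ primesUpTo z, (1 - 1 / (p : ℝ)) := by
    calc Real.exp (-(48 * a)) ≤ Real.exp (∑ p ∈ primesUpTo y \ primesUpTo z,
          -(4 * ((1 : ℝ) / p))) := by
          rw [Real.exp_le_exp, sum_neg_distrib, ← mul_sum]; linarith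
      _ = ∏ p ∈ primesUpTo y \ primesUpTo z, Real.exp (-(4 * ((1 : ℝ) / p))) := Real.exp_sum _ _
      _ ≤ _ := by
          refine prod_le_prod (fun _ _ => (Real.exp_pos _).le) fun p hp => ?_
          rw [mem_sdiff, mem_primesUpTo] at hp
          simpa using exp_neg_le_one_sub hp.1.1 (ν := 1) (by norm_num) (fun _ => le_rfl)
  have hprod : siftedDensity y =
      (∏ p ∈ primesUpTo y \ primesUpTo z, (1 - 1 / (p : ℝ))) * siftedDensity z := by
    rw [siftedDensity_eq, siftedDensity_eq, prod_sdiff hsub]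
  have h1 : Real.exp (-(48 * a)) * siftedDensity z ≤ siftedDensity y := by
    rw [hprod]
    exact mul_le_mul_of_nonneg_right hge (siftedDensity_pos z).le
  calc siftedDensity z = Real.exp (48 * a) * (Real.exp (-(48 * a)) * siftedDensity z) := by
        rw [← mul_assoc, ← Real.exp_add]; simp
    _ ≤ _ := by gcongr

/-! ### Choice of parameters, large u and bounded u -/

theorem exists_odd_ge_sub_two {v : ℝ} (hv : 1 ≤ v) : ∃ n : ℕ, Odd n ∧ (n : ℝ) ≤ v ∧ v - 2 ≤ n := by
  have h1 : 1 ≤ ⌊v⌋₊ := Nat.le_floor (by simpa using hv)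
  have h2 : (⌊v⌋₊ : ℝ) ≤ v := Nat.floor_le (by linarith)
  have h3 : v < ⌊v⌋₊ + 1 := Nat.lt_floor_add_one v
  rcases Nat.even_or_odd ⌊v⌋₊ with he | ho
  · refine ⟨⌊v⌋₊ - 1, Nat.Even.sub_odd h1 he odd_one, ?_, ?_⟩
    · rw [Nat.cast_sub h1]; push_cast; linarith
    · rw [Nat.cast_sub h1]; push_cast; linarith
  · exact ⟨⌊v⌋₊, ho, h2, by linarith⟩

/-- From `n ^ n ≤ e ^ n * n!` the error is at most `exp (72k) * (48ke / u) ^ n`. Half of `δ` pays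
for `n` being smaller than `u`, the other half for the constants depending on `k`. -/
theorem sieveError_le_rpow {δ u : ℝ} {k n : ℕ} (hδ0 : 0 < δ) (hδ1 : δ < 1) (hk : 1 ≤ k)
    (hn : (1 - δ / 2) * u ≤ n) (hu : 1 ≤ u)
    (hlog : Real.log (48 * k * Real.exp 1) + 72 * k ≤ δ / 2 * Real.log u) :
    sieveError k n ≤ u ^ (-(u * (1 - δ))) := by
  have hu0 : 0 < u := by linarith
  have hk1 : (1 : ℝ) ≤ k := by exact_mod_cast hk
  have hn2 : u / 2 ≤ n := by nlinarith
  have hn0 : (0 : ℝ) < n := by linarith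
  set B : ℝ := 48 * k * Real.exp 1 with hB
  have hB1 : 1 ≤ B := by
    have := Real.one_le_exp (show (0 : ℝ) ≤ 1 by norm_num)
    nlinarith
  have hB0 : 0 < B := by linarith
  have hlB : 0 ≤ Real.log B := Real.log_nonneg hB1
  have hlu : 0 ≤ Real.log u := Real.log_nonneg hu
  have hf : (0 : ℝ) < n.factorial := by exact_mod_cast n.factorial_pos
  have h1 : (24 * k : ℝ) ^ n / n.factorial ≤ (B / u) ^ n := by
    have hexp := Real.pow_div_factorial_le_exp (n : ℝ) (Nat.cast_nonneg n) n
    rw [div_le_iff₀ hf] at hexp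
    rw [div_le_iff₀ hf]
    have h2 : (u / 2) ^ n ≤ Real.exp n * n.factorial :=
      (pow_le_pow_left₀ (by positivity) hn2 n).trans hexp
    have h3 : Real.exp n = Real.exp 1 ^ n := by rw [← Real.exp_nat_mul, mul_one]
    rw [h3] at h2
    calc (24 * k : ℝ) ^ n = (48 * k / u) ^ n * (u / 2) ^ n := by
          rw [← mul_pow]; congr 1; field_simp; norm_num
      _ ≤ (48 * k / u) ^ n * (Real.exp 1 ^ n * n.factorial) := by gcongr
      _ = (B / u) ^ n * n.factorial := by
          rw [← mul_assoc, ← mul_pow]; congr 2; rw [hB]; ring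
  have h2 : (B / u) ^ n = Real.exp (-(n * (Real.log u - Real.log B))) := by
    rw [← Real.exp_log (show 0 < B / u by positivity), ← Real.exp_nat_mul,
      Real.log_div hB0.ne' hu0.ne']
    congr 1; ring
  rw [sieveError, Real.rpow_def_of_pos hu0]
  calc Real.exp (72 * k) * ((24 * k : ℝ) ^ n / n.factorial)
      ≤ Real.exp (72 * k) * Real.exp (-(n * (Real.log u - Real.log B))) := by
        rw [← h2]; gcongr
    _ = Real.exp (72 * k - n * (Real.log u - Real.log B)) := by
        rw [← Real.exp_add]; congr 1
    _ ≤ _ := by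
        rw [Real.exp_le_exp]
        set ℓ := Real.log u
        set b := Real.log B
        have hpos : 0 ≤ ℓ - b := by nlinarith
        have h3 : (1 - δ / 2) * u * (ℓ - b) ≤ n * (ℓ - b) := mul_le_mul_of_nonneg_right hn hpos
        have h4 : u * (b + 72 * k) ≤ u * (δ / 2 * ℓ) := mul_le_mul_of_nonneg_left hlog hu0.le
        have h5 : 72 * (k : ℝ) ≤ u * (72 * k) := by nlinarith
        have h6 : 0 ≤ δ / 2 * u * b := by positivity
        nlinarith

/-- The parameters of the sieve for a given level `u`. -/
theorem exists_sieve_parameters {δ : ℝ} (hδ0 : 0 < δ) (hδ1 : δ < 1) :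
    ∃ k : ℕ, 1 ≤ k ∧ ∃ U : ℝ, 1 ≤ U ∧ ∀ u, U ≤ u → ∃ n : ℕ, Odd n ∧
      n * (1 + 2 / 2 ^ k) + 4 ≤ u ∧ sieveError k n ≤ u ^ (-(u * (1 - δ))) := by
  obtain ⟨k₀, hk₀⟩ := exists_pow_lt_of_lt_one (show 0 < δ / 8 by positivity)
    (show (1 / 2 : ℝ) < 1 by norm_num)
  set k := k₀ + 1 with hkdef
  have hk : (2 : ℝ) / 2 ^ k ≤ δ / 4 := by
    have h1 : (1 / 2 : ℝ) ^ k ≤ (1 / 2) ^ k₀ :=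
      pow_le_pow_of_le_one (by norm_num) (by norm_num) (by omega)
    have h2 : (2 : ℝ) / 2 ^ k = 2 * (1 / 2) ^ k := by rw [div_pow, one_pow]; ring
    rw [h2]; linarith
  -- The ratio of the blocks costs a factor `1 - δ / 4` in `n`. The shift 4 in the level and the
  -- rounding to an odd integer cost at most 6 more, covered by `δ * u / 4` once `δ * u ≥ 24`.
  refine ⟨k, by omega, max (24 / δ)
    (Real.exp (2 / δ * (Real.log (48 * k * Real.exp 1) + 72 * k))), ?_, fun u hu => ?_⟩
  · refine le_max_of_le_left ?_
    rw [le_div_iff₀ hδ0]; linarith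
  · have hu1 : 24 / δ ≤ u := (le_max_left _ _).trans hu
    have hu2 := (le_max_right _ _).trans hu
    have hu24 : 24 ≤ δ * u := by rw [div_le_iff₀ hδ0] at hu1; linarith
    have hu24' : 24 ≤ u := by nlinarith
    set r : ℝ := 2 / 2 ^ k with hr
    have hr0 : 0 ≤ r := by positivity
    have hv : (u - 4) * (1 - δ / 4) ≤ (u - 4) / (1 + r) := by
      rw [le_div_iff₀ (by linarith)]
      have h1 : (1 - δ / 4) * (1 + r) ≤ 1 := by nlinarith
      nlinarith
    have hv1 : 1 ≤ (u - 4) / (1 + r) := by nlinarith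
    obtain ⟨n, hodd, hle, hge⟩ := exists_odd_ge_sub_two hv1
    refine ⟨n, hodd, ?_, ?_⟩
    · rw [le_div_iff₀ (by linarith)] at hle; linarith
    · refine sieveError_le_rpow hδ0 hδ1 (by omega) ?_ (by linarith) ?_
      · nlinarith
      · have h := (Real.le_log_iff_exp_le (by linarith)).2 hu2
        calc _ = δ / 2 * (2 / δ * (Real.log (48 * k * Real.exp 1) + 72 * k)) := by field_simp
          _ ≤ _ := by gcongr

/-- The fundamental lemma at level `y ^ u`, with constant `C` and exponent loss `δ`. -/
def FundamentalLemmaAt (C u δ : ℝ) : Prop :=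
  ∀ y : ℕ, 2 ≤ y → ∀ i j X : ℕ,
    |∑ m ∈ range X, alphaSifted y (m + i) * alphaSifted y (m + j) - X * pairDensity y i j| ≤
      C * (X * (siftedDensity y * u ^ (-(u * (1 - δ)))) + friableOmegaSum ((y : ℝ) ^ u) y)

/-- If `i` and `j` have different parity, both the sum and the density vanish. Otherwise the sieve
applies, and `6 = 2 * 3` because the remaining exponential is at most `e < 3`. -/
theorem fundamentalLemmaAt_six {δ : ℝ} (hδ0 : 0 < δ) (hδ1 : δ < 1) :
    ∃ U : ℝ, 1 ≤ U ∧ ∀ u, U ≤ u → FundamentalLemmaAt 6 u δ := by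
  obtain ⟨k, hk, U, hU, h⟩ := exists_sieve_parameters hδ0 hδ1
  refine ⟨U, hU, fun u hu y hy i j X => ?_⟩
  have hu0 : 0 < u := by linarith
  have hψ := friableOmegaSum_nonneg ((y : ℝ) ^ u) y
  have hP := (siftedDensity_pos y).le
  have hη : 0 ≤ u ^ (-(u * (1 - δ))) := by positivity
  by_cases hij : i ≡ j [MOD 2]
  · obtain ⟨n, hodd, hn, hs⟩ := h u hu
    refine (abs_sum_pair_sub_le hy hk hodd hn hij X).trans ?_
    have hs1 : sieveError k n ≤ 1 :=
      hs.trans (Real.rpow_le_one_of_one_le_of_nonpos (by linarith) (by nlinarith))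
    have hs0 : 0 ≤ sieveError k n := by unfold sieveError; positivity
    have he : Real.exp (sieveError k n) ≤ 3 :=
      (Real.exp_le_exp.2 hs1).trans (by linarith [Real.exp_one_lt_d9])
    have hle : pairDensity y i j * (sieveError k n * Real.exp (sieveError k n)) ≤
        siftedDensity y * (u ^ (-(u * (1 - δ))) * 3) := by
      have := pairDensity_le y i j
      gcongr
    have hX : (0 : ℝ) ≤ 2 * X := by positivity
    nlinarith [mul_le_mul_of_nonneg_left hle hX]
  · rw [sum_eq_zero fun m _ => alphaSifted_mul_eq_zero hy hij m, pairDensity_of_not_modEq hy hij]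
    simp only [mul_zero, sub_zero, abs_zero]
    positivity

theorem FundamentalLemmaAt.mono {C C' u δ : ℝ} (hu : 0 < u) (h : FundamentalLemmaAt C u δ)
    (hC : C ≤ C') : FundamentalLemmaAt C' u δ := by
  intro y hy i j X
  refine (h y hy i j X).trans ?_
  have hψ := friableOmegaSum_nonneg ((y : ℝ) ^ u) y
  have hP := (siftedDensity_pos y).le
  have hη : 0 ≤ u ^ (-(u * (1 - δ))) := by positivity
  gcongr

/-- An upper bound survives when fewer primes are sieved. Taking `z` about `y ^ (1 / 2 ^ a)` puts
the level `z ^ 2 ^ a` below `y ≤ y ^ u`, while the density grows only by a constant factor. -/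
theorem exists_sum_alphaSifted_le : ∃ C : ℝ, 1 ≤ C ∧ ∀ u : ℝ, 1 ≤ u → ∀ y : ℕ, 2 ≤ y →
    ∀ i X : ℕ, ∑ m ∈ range X, alphaSifted y (m + i) ≤
      C * (X * siftedDensity y + friableOmegaSum ((y : ℝ) ^ u) y) := by
  obtain ⟨U, hU, h⟩ := fundamentalLemmaAt_six (δ := 1 / 2) (by norm_num) (by norm_num)
  obtain ⟨a, ha⟩ := pow_unbounded_of_one_lt U (show (1 : ℝ) < 2 by norm_num)
  refine ⟨7 * Real.exp (48 * a), ?_, fun u hu y hy i X => ?_⟩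
  · have := Real.one_le_exp (show (0 : ℝ) ≤ 48 * a by positivity)
    linarith
  have hE := Real.one_le_exp (show (0 : ℝ) ≤ 48 * a by positivity)
  have hy1 : (1 : ℝ) ≤ y := by exact_mod_cast (by omega : 1 ≤ y)
  have hψ := friableOmegaSum_nonneg ((y : ℝ) ^ u) y
  have hP := (siftedDensity_pos y).le
  set z := Nat.findGreatest (fun z => z ^ 2 ^ a ≤ y) y with hz
  have hz1 : 1 ≤ z := Nat.le_findGreatest (by omega) (by simp; omega)
  have hzy : z ≤ y := Nat.findGreatest_le y
  have hzp : z ^ 2 ^ a ≤ y := Nat.findGreatest_spec (P := fun z => z ^ 2 ^ a ≤ y) (m := 1)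
    (by omega) (by simp; omega)
  have hlt : y < (z + 1) ^ 2 ^ a := by
    by_contra hc
    push Not at hc
    have h1 : z + 1 ≤ y := (Nat.le_self_pow (by positivity) (z + 1)).trans hc
    exact Nat.findGreatest_is_greatest (P := fun z => z ^ 2 ^ a ≤ y) (Nat.lt_succ_self z) h1 hc
  have hdens := siftedDensity_le_mul hz1 hzy hlt
  have hX : (0 : ℝ) ≤ X := Nat.cast_nonneg X
  have hmono : ∑ m ∈ range X, alphaSifted y (m + i) ≤ ∑ m ∈ range X, alphaSifted z (m + i) :=
    sum_le_sum fun m _ => alphaSifted_anti hzy _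
  have hkey : ∑ m ∈ range X, alphaSifted z (m + i) ≤
      7 * (X * siftedDensity z) + 6 * friableOmegaSum ((y : ℝ) ^ u) y := by
    -- For `z = 1` nothing is sieved and the trivial bound suffices; the fundamental lemma needs `2
    -- ≤ z`.
    rcases hz1.eq_or_lt with h1 | h1
    · rw [← h1]
      have hd1 : siftedDensity 1 = 1 := by
        rw [siftedDensity_eq]
        refine prod_eq_one fun p hp => ?_
        rw [mem_primesUpTo] at hp
        have := hp.1.two_le
        omega
      rw [hd1]
      have : ∑ m ∈ range X, alphaSifted 1 (m + i) ≤ X := by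
        refine (sum_le_sum fun m _ => alphaSifted_le_one 1 (m + i)).trans ?_
        simp
      linarith
    · have hfl := h (2 ^ a) ha.le z h1 i i X
      simp_rw [alphaSifted_mul_self] at hfl
      rw [pairDensity_self] at hfl
      have hη : ((2 : ℝ) ^ a) ^ (-((2 : ℝ) ^ a * (1 - 1 / 2))) ≤ 1 :=
        Real.rpow_le_one_of_one_le_of_nonpos (by linarith) (by
          have : (0 : ℝ) < 2 ^ a := by positivity
          linarith)
      have hψz : friableOmegaSum ((z : ℝ) ^ ((2 : ℝ) ^ a)) z ≤ friableOmegaSum ((y : ℝ) ^ u) y := by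
        refine friableOmegaSum_mono ?_ hzy
        have h2 : ((z : ℝ) ^ ((2 : ℝ) ^ a)) ≤ y := by
          have : ((2 : ℝ) ^ a) = ((2 ^ a : ℕ) : ℝ) := by push_cast; rfl
          rw [this, Real.rpow_natCast]
          exact_mod_cast hzp
        refine h2.trans ?_
        simpa using Real.rpow_le_rpow_of_exponent_le hy1 hu
      have hz0 := (siftedDensity_pos z).le
      have h3 : (X : ℝ) * (siftedDensity z * ((2 : ℝ) ^ a) ^ (-((2 : ℝ) ^ a * (1 - 1 / 2)))) ≤
          X * (siftedDensity z * 1) := by gcongr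
      linarith [(abs_le.1 hfl).2]
  have h4 : (X : ℝ) * siftedDensity z ≤ X * (Real.exp (48 * a) * siftedDensity y) := by gcongr
  have h5 : 6 * friableOmegaSum ((y : ℝ) ^ u) y ≤
      7 * Real.exp (48 * a) * friableOmegaSum ((y : ℝ) ^ u) y := by
    have : (6 : ℝ) ≤ 7 * Real.exp (48 * a) := by linarith
    gcongr
  nlinarith

/-- The loss `δ = 1` makes the power of `u` equal to 1, so the claim for all `u ≥ 1` is only an
order-of-magnitude bound. -/
theorem exists_fundamentalLemmaAt : ∃ C : ℝ, 0 < C ∧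
    (∀ u, 1 ≤ u → FundamentalLemmaAt C u 1) ∧
    ∀ δ : ℝ, 0 < δ → δ < 1 → ∃ U : ℝ, ∀ u, U ≤ u → FundamentalLemmaAt C u δ := by
  obtain ⟨C, hC, h⟩ := exists_sum_alphaSifted_le
  refine ⟨C + 6, by linarith, fun u hu y hy i j X => ?_, fun δ hδ0 hδ1 => ?_⟩
  · have hψ := friableOmegaSum_nonneg ((y : ℝ) ^ u) y
    have hX : (0 : ℝ) ≤ X := Nat.cast_nonneg X
    have hXP := mul_nonneg hX (siftedDensity_pos y).le
    have h1 := h u hu y hy i X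
    have h2 : ∑ m ∈ range X, alphaSifted y (m + i) * alphaSifted y (m + j) ≤
        ∑ m ∈ range X, alphaSifted y (m + i) :=
      sum_le_sum fun m _ => mul_le_of_le_one_right (alphaSifted_nonneg _ _) (alphaSifted_le_one _ _)
    have h3 : 0 ≤ ∑ m ∈ range X, alphaSifted y (m + i) * alphaSifted y (m + j) :=
      sum_nonneg fun m _ => mul_nonneg (alphaSifted_nonneg _ _) (alphaSifted_nonneg _ _)
    have h4 : (X : ℝ) * pairDensity y i j ≤ X * siftedDensity y :=
      mul_le_mul_of_nonneg_left (pairDensity_le y i j) hX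
    have h5 : 0 ≤ (X : ℝ) * pairDensity y i j := mul_nonneg hX (pairDensity_nonneg y i j)
    simp only [sub_self, mul_zero, neg_zero, Real.rpow_zero, mul_one]
    rw [abs_le]
    constructor <;> nlinarith
  · obtain ⟨U, hU, hfl⟩ := fundamentalLemmaAt_six hδ0 hδ1
    exact ⟨U, fun u hu => (hfl u hu).mono (by linarith) (by linarith)⟩

/-- Choice of a loss `δ(u) → 0` from a family of statements valid for `u` large. -/
theorem exists_tendsto_zero {Q : ℝ → ℝ → Prop} (h1 : ∀ u, 1 ≤ u → Q u 1)
    (h : ∀ δ : ℝ, 0 < δ → δ < 1 → ∃ U : ℝ, ∀ u, U ≤ u → Q u δ) :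
    ∃ δ : ℝ → ℝ, (∀ u, 0 ≤ δ u ∧ δ u ≤ 1) ∧ Filter.Tendsto δ Filter.atTop (nhds 0) ∧
      ∀ u, 1 ≤ u → Q u (δ u) := by
  set D : ℝ → Set ℝ := fun u => {δ | 0 ≤ δ ∧ δ ≤ 1 ∧ (1 ≤ u → Q u δ)} with hD
  have hne : ∀ u, (D u).Nonempty := fun u => ⟨1, by norm_num, le_rfl, h1 u⟩
  have hbdd : ∀ u, BddBelow (D u) := fun u => ⟨0, fun δ hδ => hδ.1⟩
  -- The infimum of the admissible losses need not be attained; a margin `exp (-u)` tending to 0 is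
  -- harmless.
  have hex : ∀ u, ∃ δ ∈ D u, δ < sInf (D u) + Real.exp (-u) := fun u =>
    exists_lt_of_csInf_lt (hne u) (by linarith [Real.exp_pos (-u)])
  choose δ hδD hδ using hex
  refine ⟨δ, fun u => ⟨(hδD u).1, (hδD u).2.1⟩, ?_, fun u => (hδD u).2.2⟩
  rw [Metric.tendsto_atTop]
  intro e he
  set d := min (e / 2) (1 / 2) with hd
  have hd0 : 0 < d := by positivity
  obtain ⟨U, hU⟩ := h d hd0 (lt_of_le_of_lt (min_le_right _ _) (by norm_num))
  have hexp : ∀ᶠ u : ℝ in Filter.atTop, Real.exp (-u) < e / 2 :=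
    (Real.tendsto_exp_neg_atTop_nhds_zero).eventually_lt_const (by linarith)
  obtain ⟨V, hV⟩ := Filter.eventually_atTop.1 hexp
  refine ⟨max U V, fun u hu => ?_⟩
  have hmem : d ∈ D u := ⟨hd0.le, (min_le_right _ _).trans (by norm_num),
    fun _ => hU u ((le_max_left _ _).trans hu)⟩
  have h2 := csInf_le (hbdd u) hmem
  have h3 := hV u ((le_max_right _ _).trans hu)
  have h4 := hδ u
  have h5 : d ≤ e / 2 := min_le_left _ _
  rw [Real.dist_eq, sub_zero, abs_of_nonneg (hδD u).1]
  linarith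

/-! ### The main term as the variance over a full period -/

/-- The odd primes up to `y`. -/
def oddPrimesUpTo (y : ℕ) : Finset ℕ := (Icc 1 y).filter (fun p => p.Prime ∧ 2 < p)

theorem mem_oddPrimesUpTo {y p : ℕ} : p ∈ oddPrimesUpTo y ↔ p.Prime ∧ 2 < p ∧ p ≤ y := by
  simp only [oddPrimesUpTo, mem_filter, mem_Icc]
  constructor
  · rintro ⟨⟨_, h⟩, hp, h2⟩; exact ⟨hp, h2, h⟩
  · rintro ⟨hp, h2, h⟩; exact ⟨⟨hp.one_lt.le, h⟩, hp, h2⟩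

theorem primesUpTo_eq_insert {y : ℕ} (hy : 2 ≤ y) : primesUpTo y = insert 2 (oddPrimesUpTo y) := by
  ext p
  rw [mem_insert, mem_primesUpTo, mem_oddPrimesUpTo]
  constructor
  · rintro ⟨hp, h⟩
    rcases hp.two_le.eq_or_lt with h2 | h2
    · exact Or.inl h2.symm
    · exact Or.inr ⟨hp, h2, h⟩
  · rintro (rfl | ⟨hp, _, h⟩)
    · exact ⟨Nat.prime_two, hy⟩
    · exact ⟨hp, h⟩

theorem two_notMem_oddPrimesUpTo (y : ℕ) : 2 ∉ oddPrimesUpTo y := fun h => by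
  rw [mem_oddPrimesUpTo] at h; omega

theorem modEq_prod_iff {S : Finset ℕ} (hS : ∀ p ∈ S, p.Prime) (i j : ℕ) :
    i ≡ j [MOD ∏ p ∈ S, p] ↔ ∀ p ∈ S, i ≡ j [MOD p] := by
  induction S using Finset.induction_on with
  | empty => simp [Nat.modEq_one]
  | insert a S ha ih =>
    have hap := hS a (mem_insert_self a S)
    have hSp : ∀ p ∈ S, p.Prime := fun p hp => hS p (mem_insert_of_mem hp)
    have hc : a.Coprime (∏ p ∈ S, p) := by
      refine Nat.Coprime.prod_right fun p hp => (Nat.coprime_primes hap (hSp p hp)).2 ?_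
      rintro rfl
      exact ha hp
    rw [prod_insert ha, ← Nat.modEq_and_modEq_iff_modEq_mul hc, ih hSp, forall_mem_insert]

/-- The number of pairs `(i, j)` in `[0, H)²` that are congruent modulo `q`. -/
theorem sum_sum_modEq (H : ℕ) {q : ℕ} (hq : 0 < q) :
    ∑ i ∈ range H, ∑ j ∈ range H, (if i ≡ j [MOD q] then (1 : ℝ) else 0) =
      (H : ℝ) ^ 2 / q +
        q * (Int.fract ((H : ℝ) / q) * (1 - Int.fract ((H : ℝ) / q))) := by
  have hcount : ∀ i, ∑ j ∈ range H, (if i ≡ j [MOD q] then (1 : ℝ) else 0) =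
      (H / q : ℕ) + if i % q < H % q then 1 else 0 := by
    intro i
    have h1 : ∑ j ∈ range H, (if i ≡ j [MOD q] then (1 : ℝ) else 0) =
        ((H.count (· ≡ i [MOD q]) : ℕ) : ℝ) := by
      rw [Nat.count_eq_card_filter_range, ← sum_boole]
      exact sum_congr rfl fun j _ => if_congr Nat.ModEq.comm rfl rfl
    rw [h1, Nat.count_modEq_card H hq]
    push_cast
    rfl
  -- With `H = q * a + b`, each of the `b` residues below `b` is taken by `a + 1` integers of `[0,
  -- H)`.
  have hsmall : ∑ i ∈ range H, (if i % q < H % q then (1 : ℝ) else 0) =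
      (H % q : ℕ) * ((H / q : ℕ) + 1) := by
    have h1 : ∀ i ∈ range H, (if i % q < H % q then (1 : ℝ) else 0) =
        ∑ r ∈ range (H % q), (if r ≡ i [MOD q] then (1 : ℝ) else 0) := by
      intro i _
      have hrq : ∀ r ∈ range (H % q), (r ≡ i [MOD q] ↔ r = i % q) := by
        intro r hr
        have : r < q := (mem_range.1 hr).trans (Nat.mod_lt H hq)
        rw [Nat.ModEq, Nat.mod_eq_of_lt this]
      rw [sum_congr rfl fun r hr => if_congr (hrq r hr) rfl rfl, sum_ite_eq']
      simp only [mem_range]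
    rw [sum_congr rfl h1, sum_comm]
    have h2 : ∀ r ∈ range (H % q), ∑ i ∈ range H, (if r ≡ i [MOD q] then (1 : ℝ) else 0) =
        (H / q : ℕ) + 1 := by
      intro r hr
      have hr' := mem_range.1 hr
      rw [hcount r, Nat.mod_eq_of_lt (hr'.trans (Nat.mod_lt H hq)), if_pos hr']
    rw [sum_congr rfl h2, sum_const, card_range, nsmul_eq_mul]
  simp_rw [hcount]
  rw [sum_add_distrib, hsmall, sum_const, card_range, nsmul_eq_mul,
    Int.fract_div_natCast_eq_div_natCast_mod]
  have h2 : (H : ℝ) = q * (H / q : ℕ) + (H % q : ℕ) := by exact_mod_cast (Nat.div_add_mod H q).symm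
  have hq' : (q : ℝ) ≠ 0 := by exact_mod_cast hq.ne'
  set a : ℝ := ((H / q : ℕ) : ℝ)
  set b : ℝ := ((H % q : ℕ) : ℝ)
  rw [h2]
  field_simp
  ring

/-- Each odd factor is `1 - 2 / p` times `1 + 1 / (p - 2)` or 1, according as `p` divides `i - j` or
not; the product is then expanded. The prime 2 is split off because `p - 2` vanishes there. -/
theorem pairDensity_eq_sum {y : ℕ} (hy : 2 ≤ y) (i j : ℕ) :
    pairDensity y i j = (∏ p ∈ oddPrimesUpTo y, (1 - 2 / (p : ℝ))) *
      ∑ S ∈ (oddPrimesUpTo y).powerset, (∏ p ∈ S, 1 / ((p : ℝ) - 2)) *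
        (1 / 2 * if i ≡ j [MOD 2 * ∏ p ∈ S, p] then 1 else 0) := by
  have hprod : ∏ p ∈ oddPrimesUpTo y, (1 - (pairRoots i j p : ℝ) / p) =
      (∏ p ∈ oddPrimesUpTo y, (1 - 2 / (p : ℝ))) * ∑ S ∈ (oddPrimesUpTo y).powerset,
        (∏ p ∈ S, 1 / ((p : ℝ) - 2)) * if i ≡ j [MOD ∏ p ∈ S, p] then 1 else 0 := by
    have h1 : ∀ p ∈ oddPrimesUpTo y, 1 - (pairRoots i j p : ℝ) / p = (1 - 2 / (p : ℝ)) *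
        (1 + 1 / ((p : ℝ) - 2) * if i ≡ j [MOD p] then 1 else 0) := by
      intro p hp
      rw [mem_oddPrimesUpTo] at hp
      have hp2 : (2 : ℝ) < p := by exact_mod_cast hp.2.1
      have h2 : (p : ℝ) - 2 ≠ 0 := by linarith
      have h3 : (p : ℝ) ≠ 0 := by linarith
      unfold pairRoots
      split_ifs
      · push_cast; field_simp; ring
      · push_cast; ring
    rw [prod_congr rfl h1, prod_mul_distrib, prod_one_add]
    congr 1
    refine sum_congr rfl fun S hS => ?_
    have hSp : ∀ p ∈ S, p.Prime := fun p hp =>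
      (mem_oddPrimesUpTo.1 (mem_powerset.1 hS hp)).1
    rw [prod_mul_distrib, prod_ite_zero, if_congr (modEq_prod_iff hSp i j) rfl rfl]
    simp
  rw [pairDensity, primesUpTo_eq_insert hy, prod_insert (two_notMem_oddPrimesUpTo y), hprod,
    mul_left_comm, mul_sum]
  congr 1
  refine sum_congr rfl fun S hS => ?_
  have hc : Nat.Coprime 2 (∏ p ∈ S, p) := by
    refine Nat.Coprime.prod_right fun p hp => ?_
    have := mem_oddPrimesUpTo.1 (mem_powerset.1 hS hp)
    exact (Nat.coprime_primes Nat.prime_two this.1).2 (by omega)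
  rw [← if_congr (Nat.modEq_and_modEq_iff_modEq_mul hc) rfl rfl]
  unfold pairRoots
  by_cases h2 : i ≡ j [MOD 2]
  · by_cases h3 : i ≡ j [MOD ∏ p ∈ S, p]
    · rw [if_pos h2, if_pos h3, if_pos ⟨h2, h3⟩]; push_cast; ring
    · rw [if_pos h2, if_neg h3, if_neg (fun h => h3 h.2)]; push_cast; ring
  · have h4 : ¬ (i ≡ j [MOD 2] ∧ i ≡ j [MOD ∏ p ∈ S, p]) := fun h => h2 h.1
    rw [if_neg h2, if_neg h4]; push_cast; ring

/-- The same expansion with each congruence replaced by its density, since `(1 - 1/p)² = (1 - 2/p)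
(1 + 1/(p (p - 2)))`. -/
theorem siftedDensity_sq {y : ℕ} (hy : 2 ≤ y) :
    siftedDensity y ^ 2 = 1 / 4 * ((∏ p ∈ oddPrimesUpTo y, (1 - 2 / (p : ℝ))) *
      ∑ S ∈ (oddPrimesUpTo y).powerset, (∏ p ∈ S, 1 / ((p : ℝ) - 2)) * (1 / ∏ p ∈ S, (p : ℝ))) := by
  have h1 : ∑ S ∈ (oddPrimesUpTo y).powerset,
      (∏ p ∈ S, 1 / ((p : ℝ) - 2)) * (1 / ∏ p ∈ S, (p : ℝ)) =
      ∏ p ∈ oddPrimesUpTo y, (1 + 1 / ((p : ℝ) - 2) * (1 / p)) := by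
    rw [prod_one_add]
    refine sum_congr rfl fun S _ => ?_
    rw [prod_mul_distrib]
    congr 1
    simp
  rw [h1, ← prod_mul_distrib, siftedDensity_eq, primesUpTo_eq_insert hy,
    prod_insert (two_notMem_oddPrimesUpTo y), mul_pow, ← prod_pow]
  congr 1
  · norm_num
  · refine prod_congr rfl fun p hp => ?_
    rw [mem_oddPrimesUpTo] at hp
    have hp2 : (2 : ℝ) < p := by exact_mod_cast hp.2.1
    have h2 : (p : ℝ) - 2 ≠ 0 := by linarith
    have h3 : (p : ℝ) ≠ 0 := by linarith
    field_simp
    ring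

theorem gSifted_prod {y : ℕ} {S : Finset ℕ} (hS : S ⊆ oddPrimesUpTo y) :
    gSifted y (∏ p ∈ S, p) = ∏ p ∈ S, (p : ℝ) / ((p : ℝ) - 2) := by
  have hSp : ∀ p ∈ S, p.Prime ∧ 2 < p ∧ p ≤ y := fun p hp => mem_oddPrimesUpTo.1 (hS hp)
  have hsq : Squarefree (∏ p ∈ S, p) := by
    refine Finset.squarefree_prod_of_pairwise_isCoprime ?_ fun p hp => (hSp p hp).1.prime.squarefree
    intro p hp q hq hpq
    exact Nat.coprime_iff_isRelPrime.1 ((Nat.coprime_primes (hSp p hp).1 (hSp q hq).1).2 hpq)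
  rw [gSifted, if_pos hsq, Nat.primeFactors_prod fun p hp => (hSp p hp).1]
  exact prod_congr rfl fun p hp => if_pos (hSp p hp).2

theorem gSifted_eq_zero {y n : ℕ}
    (hn : n ∉ (oddPrimesUpTo y).powerset.image (fun S => ∏ p ∈ S, p)) : gSifted y n = 0 := by
  unfold gSifted
  split_ifs with hsq
  · by_contra hne
    rw [← ne_eq, prod_ne_zero_iff] at hne
    refine hn (mem_image.2 ⟨n.primeFactors, mem_powerset.2 fun p hp => ?_,
      Nat.prod_primeFactors_of_squarefree hsq⟩)
    have h := hne p hp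
    rw [mem_oddPrimesUpTo]
    by_cases hc : 2 < p ∧ p ≤ y
    · exact ⟨Nat.prime_of_mem_primeFactors hp, hc⟩
    · simp [hc] at h
  · rfl

theorem siftedMainTerm_eq_sum (H y : ℕ) :
    siftedMainTerm H y = (∏ p ∈ oddPrimesUpTo y, (1 - 2 / (p : ℝ))) *
      ∑ S ∈ (oddPrimesUpTo y).powerset, (∏ p ∈ S, (p : ℝ) / ((p : ℝ) - 2)) *
        (Int.fract ((H : ℝ) / ((2 * ∏ p ∈ S, p : ℕ) : ℝ)) *
          (1 - Int.fract ((H : ℝ) / ((2 * ∏ p ∈ S, p : ℕ) : ℝ)))) := by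
  unfold siftedMainTerm
  have hinj : Set.InjOn (fun S : Finset ℕ => ∏ p ∈ S, p) (oddPrimesUpTo y).powerset := by
    intro S hS S' hS' h
    have hpf : ∀ T ∈ (oddPrimesUpTo y).powerset, (∏ p ∈ T, p).primeFactors = T := fun T hT =>
      Nat.primeFactors_prod fun p hp => (mem_oddPrimesUpTo.1 (mem_powerset.1 hT hp)).1
    rw [← hpf S hS, ← hpf S' hS']
    exact congrArg Nat.primeFactors h
  rw [tsum_eq_sum (s := (oddPrimesUpTo y).powerset.image (fun S => ∏ p ∈ S, p))
    (fun n hn => by rw [gSifted_eq_zero hn, zero_mul]), sum_image hinj]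
  refine congrArg₂ _ rfl (sum_congr rfl fun S hS => ?_)
  rw [gSifted_prod (mem_powerset.1 hS)]
  push_cast
  rfl

/-- The main term is the variance over a full period. -/
theorem sum_pairDensity_eq {y : ℕ} (hy : 2 ≤ y) (H : ℕ) :
    ∑ i ∈ range H, ∑ j ∈ range H, pairDensity y i j =
      (H : ℝ) ^ 2 * siftedDensity y ^ 2 + siftedMainTerm H y := by
  simp_rw [pairDensity_eq_sum hy, ← mul_sum]
  rw [siftedDensity_sq hy, siftedMainTerm_eq_sum]
  set P := ∏ p ∈ oddPrimesUpTo y, (1 - 2 / (p : ℝ))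
  have h1 : ∑ i ∈ range H, ∑ j ∈ range H, ∑ S ∈ (oddPrimesUpTo y).powerset,
      (∏ p ∈ S, 1 / ((p : ℝ) - 2)) * (1 / 2 * if i ≡ j [MOD 2 * ∏ p ∈ S, p] then 1 else 0) =
      ∑ S ∈ (oddPrimesUpTo y).powerset, (∏ p ∈ S, 1 / ((p : ℝ) - 2)) * (1 / 2 *
        ∑ i ∈ range H, ∑ j ∈ range H, if i ≡ j [MOD 2 * ∏ p ∈ S, p] then (1 : ℝ) else 0) := by
    simp_rw [mul_sum]
    rw [sum_congr rfl fun i _ => sum_comm, sum_comm]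
  rw [h1, mul_left_comm (1 / 4 : ℝ) P, mul_left_comm _ P, ← mul_add]
  congr 1
  rw [mul_sum, mul_sum, ← sum_add_distrib]
  refine sum_congr rfl fun S hS => ?_
  have hSp : ∀ p ∈ S, p.Prime := fun p hp => (mem_oddPrimesUpTo.1 (mem_powerset.1 hS hp)).1
  have hpos : 0 < ∏ p ∈ S, p := prod_pos fun p hp => (hSp p hp).pos
  have hg : ∏ p ∈ S, (p : ℝ) / ((p : ℝ) - 2) =
      (∏ p ∈ S, 1 / ((p : ℝ) - 2)) * ((∏ p ∈ S, p : ℕ) : ℝ) := by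
    push_cast
    rw [← prod_mul_distrib]
    exact prod_congr rfl fun p _ => by ring
  -- With `q = 2N`, half of `H² / q` is the term `H² / (4N)` of `H² P²`. Half of the factor `q` is
  -- `N`, which turns the product of `1 / (p - 2)` into `g_y(N)`.
  rw [sum_sum_modEq H (by omega : 0 < 2 * ∏ p ∈ S, p), hg, ← Nat.cast_prod]
  have hne : ((∏ p ∈ S, p : ℕ) : ℝ) ≠ 0 := by exact_mod_cast hpos.ne'
  rw [Nat.cast_mul]
  generalize ((∏ p ∈ S, p : ℕ) : ℝ) = N at *
  generalize Int.fract ((H : ℝ) / (((2 : ℕ) : ℝ) * N)) = φ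
  push_cast
  field_simp
  ring

theorem pairDensity_succ_succ (y i j : ℕ) : pairDensity y (i + 1) (j + 1) = pairDensity y i j := by
  refine prod_congr rfl fun p _ => ?_
  have h : (i + 1 ≡ j + 1 [MOD p]) ↔ (i ≡ j [MOD p]) :=
    ⟨fun h => Nat.ModEq.add_right_cancel' 1 h, fun h => h.add_right 1⟩
  rw [pairRoots, pairRoots, if_congr h rfl rfl]

/-! ### From the variance to correlations, and conclusion -/

theorem integral_eq_sum_of_eq_on_unit_intervals {f : ℝ → ℝ} {a : ℕ → ℝ}
    (h : ∀ m : ℕ, ∀ x ∈ Set.Ico (m : ℝ) (m + 1), f x = a m) (X : ℕ) :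
    ∫ x in (0 : ℝ)..(X : ℝ), f x = ∑ m ∈ range X, a m := by
  have hae : ∀ m : ℕ, ∀ᵐ x : ℝ, x ∈ Set.uIoc (m : ℝ) ((m + 1 : ℕ) : ℝ) → f x = a m := by
    intro m
    have hne : ∀ᵐ x : ℝ, x ≠ ((m + 1 : ℕ) : ℝ) := by
      simp [MeasureTheory.ae_iff]
    filter_upwards [hne] with x hx hmem
    rw [Set.uIoc_of_le (by push_cast; linarith)] at hmem
    refine h m x ⟨hmem.1.le, ?_⟩
    have := lt_of_le_of_ne hmem.2 hx
    push_cast at this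
    exact this
  have h_integrable : ∀ m : ℕ, IntervalIntegrable f MeasureTheory.volume (m : ℝ) ((m + 1 : ℕ) : ℝ) := by
    intro m
    refine (intervalIntegrable_const (c := a m)).congr_ae ?_
    rw [Filter.EventuallyEq, MeasureTheory.ae_restrict_iff' measurableSet_uIoc]
    filter_upwards [hae m] with x hx hmem
    exact (hx hmem).symm
  have hsum := intervalIntegral.sum_integral_adjacent_intervals (f := f) (a := fun m : ℕ => (m : ℝ))
    (μ := MeasureTheory.volume) (n := X) fun m _ => h_integrable m
  rw [Nat.cast_zero] at hsum
  rw [← hsum]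
  refine sum_congr rfl fun m _ => ?_
  rw [intervalIntegral.integral_congr_ae (hae m), intervalIntegral.integral_const]
  simp

theorem siftedVariance_eq (X H y : ℕ) :
    siftedVariance X H y = 1 / X * ∑ m ∈ range X,
      (∑ i ∈ range H, alphaSifted y (m + (i + 1)) - H * siftedDensity y) ^ 2 := by
  unfold siftedVariance
  congr 1
  refine integral_eq_sum_of_eq_on_unit_intervals (fun m x hx => ?_) X
  have hx0 : 0 ≤ x := (Nat.cast_nonneg m).trans hx.1
  have hm : ⌊x⌋₊ = m := (Nat.floor_eq_iff hx0).2 hx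
  rw [Nat.floor_add_natCast hx0, hm]
  congr 2
  rw [← Finset.Ico_succ_succ_eq_Ioc, Finset.sum_Ico_eq_sum_range]
  simp only [Order.succ_eq_add_one]
  rw [show m + H + 1 - (m + 1) = H by omega]
  exact sum_congr rfl fun i _ => by congr 1; ring

/-- The linear term is written with squares, as α² = α, so that the fundamental lemma for pairs also
covers the first moment. -/
theorem sum_sq_expansion (X H y : ℕ) :
    ∑ m ∈ range X, (∑ i ∈ range H, alphaSifted y (m + (i + 1)) - H * siftedDensity y) ^ 2 =
      ∑ i ∈ range H, ∑ j ∈ range H,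
        ∑ m ∈ range X, alphaSifted y (m + (i + 1)) * alphaSifted y (m + (j + 1)) -
      2 * (H * siftedDensity y) * ∑ i ∈ range H,
        ∑ m ∈ range X, alphaSifted y (m + (i + 1)) * alphaSifted y (m + (i + 1)) +
      X * (H * siftedDensity y) ^ 2 := by
  have h1 : ∑ i ∈ range H, ∑ j ∈ range H,
        ∑ m ∈ range X, alphaSifted y (m + (i + 1)) * alphaSifted y (m + (j + 1)) =
      ∑ m ∈ range X, (∑ i ∈ range H, alphaSifted y (m + (i + 1))) ^ 2 := by
    rw [sum_congr rfl fun i _ => sum_comm, sum_comm]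
    refine sum_congr rfl fun m _ => ?_
    rw [sq, sum_mul_sum]
  have h2 : ∑ i ∈ range H, ∑ m ∈ range X,
        alphaSifted y (m + (i + 1)) * alphaSifted y (m + (i + 1)) =
      ∑ m ∈ range X, ∑ i ∈ range H, alphaSifted y (m + (i + 1)) := by
    simp_rw [alphaSifted_mul_self]
    exact sum_comm
  have h3 : (X : ℝ) * (H * siftedDensity y) ^ 2 =
      ∑ m ∈ range X, (H * siftedDensity y) ^ 2 := by simp
  rw [h1, h2, h3, mul_sum, ← sum_sub_distrib, ← sum_add_distrib]
  exact sum_congr rfl fun m _ => by ring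

theorem abs_siftedVariance_sub_le {C u δ : ℝ} (hfl : FundamentalLemmaAt C u δ) {X H y : ℕ}
    (hy : 2 ≤ y) (hX : 1 ≤ X) :
    |siftedVariance X H y - siftedMainTerm H y| ≤
      3 * C * ((H : ℝ) ^ 2 * (siftedDensity y * u ^ (-(u * (1 - δ))) +
        friableOmegaSum ((y : ℝ) ^ u) y / X)) := by
  have hX0 : (0 : ℝ) < X := by exact_mod_cast hX
  set P := siftedDensity y with hP
  have hP0 : 0 < P := siftedDensity_pos y
  have hP1 : P ≤ 1 := siftedDensity_le_one y
  set R := C * (X * (P * u ^ (-(u * (1 - δ)))) + friableOmegaSum ((y : ℝ) ^ u) y) with hR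
  set A : ℕ → ℕ → ℝ := fun i j =>
    ∑ m ∈ range X, alphaSifted y (m + (i + 1)) * alphaSifted y (m + (j + 1)) with hA
  have hAR : ∀ i j, |A i j - X * pairDensity y i j| ≤ R := by
    intro i j
    have := hfl y hy (i + 1) (j + 1) X
    rwa [pairDensity_succ_succ] at this
  have hR0 : 0 ≤ R := (abs_nonneg _).trans (hAR 0 0)
  have hM := sum_pairDensity_eq hy H
  have hdiff : X * (siftedVariance X H y - siftedMainTerm H y) =
      ∑ i ∈ range H, ∑ j ∈ range H, (A i j - X * pairDensity y i j) -
        2 * (H * P) * ∑ i ∈ range H, (A i i - X * pairDensity y i i) := by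
    have e1 : ∑ i ∈ range H, ∑ j ∈ range H, (A i j - X * pairDensity y i j) =
        ∑ i ∈ range H, ∑ j ∈ range H, A i j -
          X * ∑ i ∈ range H, ∑ j ∈ range H, pairDensity y i j := by
      simp_rw [sum_sub_distrib, mul_sum]
    have e2 : ∑ i ∈ range H, (A i i - X * pairDensity y i i) =
        ∑ i ∈ range H, A i i - X * (H * P) := by
      simp_rw [pairDensity_self, sum_sub_distrib]
      simp
      ring
    have e3 : ∑ m ∈ range X, (∑ i ∈ range H, alphaSifted y (m + (i + 1)) - H * P) ^ 2 =
        ∑ i ∈ range H, ∑ j ∈ range H, A i j - 2 * (H * P) * ∑ i ∈ range H, A i i +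
          X * (H * P) ^ 2 := sum_sq_expansion X H y
    rw [e1, e2, hM, siftedVariance_eq, ← hP, e3]
    field_simp
    ring
  have hb1 : |∑ i ∈ range H, ∑ j ∈ range H, (A i j - X * pairDensity y i j)| ≤ H * (H * R) := by
    calc _ ≤ ∑ i ∈ range H, ∑ j ∈ range H, |A i j - X * pairDensity y i j| :=
          (abs_sum_le_sum_abs _ _).trans (sum_le_sum fun i _ => abs_sum_le_sum_abs _ _)
      _ ≤ ∑ i ∈ range H, ∑ j ∈ range H, R := sum_le_sum fun i _ => sum_le_sum fun j _ => hAR i j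
      _ = _ := by simp
  have hb2 : |∑ i ∈ range H, (A i i - X * pairDensity y i i)| ≤ H * R := by
    calc _ ≤ ∑ i ∈ range H, |A i i - X * pairDensity y i i| := abs_sum_le_sum_abs _ _
      _ ≤ ∑ i ∈ range H, R := sum_le_sum fun i _ => hAR i i
      _ = _ := by simp
  -- Bounding `P` by 1 here gives `2 H² R`; with `H² R` from the pairs this makes the constant 3.
  have hb3 : |2 * (H * P) * ∑ i ∈ range H, (A i i - X * pairDensity y i i)| ≤
      2 * (H * 1) * (H * R) := by
    rw [abs_mul, abs_of_nonneg (by positivity : 0 ≤ 2 * (H * P))]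
    gcongr
  have hfinal : |X * (siftedVariance X H y - siftedMainTerm H y)| ≤ 3 * (H : ℝ) ^ 2 * R := by
    rw [hdiff]
    refine (abs_sub _ _).trans ?_
    linarith
  rw [abs_mul, Nat.abs_cast, mul_comm, ← le_div_iff₀ hX0] at hfinal
  refine hfinal.trans (le_of_eq ?_)
  rw [hR]
  field_simp

theorem mainTheorem4 :
    ∃ (C : ℝ) (ε : ℝ → ℝ), 0 < C ∧ (∀ u : ℝ, 1 ≤ u → |ε u| ≤ 1) ∧
      Filter.Tendsto ε Filter.atTop (nhds 0) ∧
      ∀ y H X : ℕ, 2 ≤ y → 1 ≤ H → 1 ≤ X → ∀ u : ℝ, 1 ≤ u →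
        |siftedVariance X H y - siftedMainTerm H y| ≤
          C * ((H : ℝ) ^ 2 *
            (siftedDensity y * u ^ (-(u * (1 + ε u))) +
              friableOmegaSum ((y : ℝ) ^ u) y / (X : ℝ))) := by
  obtain ⟨C, hC, h1, hδ⟩ := exists_fundamentalLemmaAt
  obtain ⟨δ, hmem, hlim, hfl⟩ := exists_tendsto_zero h1 hδ
  refine ⟨3 * C, fun u => -δ u, by linarith, fun u _ => ?_, by simpa using hlim.neg,
    fun y H X hy _ hX u hu => ?_⟩
  · rw [abs_neg, abs_of_nonneg (hmem u).1]; exact (hmem u).2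
  · simpa only [sub_eq_add_neg] using abs_siftedVariance_sub_le (H := H) (hfl u hu) hy hX
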